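/- There is a constant $K\ge 2$ such that for every odd prime $p$ there are constants $c_1,c_2,c_3>0$ for which the following holds. For infinitely many $n$ there exist two non-isomorphic finite groups $G$ and $H$ of order $n$ such that: 1. $G$ and $H$ have (Version II) Weisfeiler-Leman dimension at most $K$, that is, $K$-WL distinguishes each of them from every finite group not isomorphic to it. 2. $G$ and $H$ have equal $k$-subgroup-profiles for some $k$ with $c_1\log n\le k\le c_2\log n$. Here the $k$-profile of a group is the multiset of isomorphism types of its $k$-generated subgroups. 3. The commuting graphs of $G$ and $H$ (vertices: group elements; distinct $g,g'$ are adjacent iff $gg'g^{-1}g'^{-1}=1$) are not distinguished by the $\ell$-dimensional Weisfeiler-Leman algorithm for graphs, for every integer $\ell$ with $1\le\ell\le c_3\log n$. 4. $G$ and $H$ have exponent $p$ and nilpotency class exactly $2$. 5. $G$ and $H$ have the same multiset of conjugacy class sizes. Here $k$-WL colors the $k$-tuples over a finite set. In Version II for groups, $(g_1,\dots,g_k)$ and $(h_1,\dots,h_k)$ get the same initial color iff $g_i\mapsto h_i$ extends to an isomorphism $\langle g_1,\dots,g_k\rangle\to\langle h_1,\dots,h_k\rangle$. For graphs they get the same initial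 color iff $g_i\mapsto h_i$ is an isomorphism of the induced subgraphs. In each round the new color of $\bar g=(g_1,\dots,g_k)$ is the pair consisting of its old color $\chi(\bar g)$ and the multiset, over all elements (vertices) $x$, of the tuples $(\chi(\bar g_{|1\leftarrow x}),\dots,\chi(\bar g_{|k\leftarrow x}))$, where $\bar g_{|j\leftarrow x}$ is $\bar g$ with its $j$-th entry replaced by $x$; for graphs and $k=1$ only the neighbors $x$ of $g_1$ are used. Two groups (graphs) are not distinguished by $k$-WL iff some bijection between their sets of $k$-tuples preserves the final colors. -/

import Mathlib

/-! ## The Weisfeiler-Leman refinement -/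

/-- The colors that `k`-dimensional color refinement can use in round `i`, when the initial
coloring has its colors in `C`. -/
def WLColor (C : Type) (k : ℕ) : ℕ → Type
  | 0 => C
  | i + 1 => WLColor C k i × Multiset (Fin k → WLColor C k i)

/-- The coloring of the `k`-tuples over `V` in round `i`, from the initial coloring `χ₀`. In each
round the color of a tuple `g` becomes its previous color together with the multiset, over all
admissible `x ∈ N g`, of the `k`-tuple of previous colors of `g` with its `j`-th entry replaced
by `x`, for `j = 1, …, k`. -/
def wlColoring {V C : Type} {k : ℕ} (N : (Fin k → V) → Finset V) (χ₀ : (Fin k → V) → C) :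
    (i : ℕ) → (Fin k → V) → WLColor C k i
  | 0 => χ₀
  | i + 1 => fun g =>
      (wlColoring N χ₀ i g,
        (N g).val.map fun x j => wlColoring N χ₀ i (Function.update g j x))

/-! ### Graphs -/

/-- The initial color of a `k`-tuple of vertices: the ordered isomorphism type of the subgraph
that it induces, recorded as its equalities and adjacencies. -/
def graphInitialColor {V : Type} (Γ : SimpleGraph V) {k : ℕ} (g : Fin k → V) :
    Fin k → Fin k → Prop × Prop :=
  fun i j => (g i = g j, Γ.Adj (g i) (g j))

/-- Two tuples get the same initial color exactly if mapping one to the other, entry by entry, is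
an isomorphism of the induced subgraphs. -/
theorem graphInitialColor_eq_iff {V W : Type} (Γ : SimpleGraph V) (Δ : SimpleGraph W) {k : ℕ}
    (g : Fin k → V) (h : Fin k → W) :
    graphInitialColor Γ g = graphInitialColor Δ h ↔
      ∃ φ : Γ.induce (Set.range g) ≃g Δ.induce (Set.range h),
        ∀ i, φ ⟨g i, Set.mem_range_self i⟩ = ⟨h i, Set.mem_range_self i⟩ := by
  constructor
  · intro e
    have e1 : ∀ i j, g i = g j ↔ h i = h j := fun i j => by
      have := congrArg Prod.fst (congrFun (congrFun e i) j)
      exact iff_of_eq this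
    have e2 : ∀ i j, Γ.Adj (g i) (g j) ↔ Δ.Adj (h i) (h j) := fun i j => by
      have := congrArg Prod.snd (congrFun (congrFun e i) j)
      exact iff_of_eq this
    let f : Set.range g → Set.range h := fun v => ⟨h v.2.choose, Set.mem_range_self _⟩
    have hf : ∀ i, f ⟨g i, Set.mem_range_self i⟩ = ⟨h i, Set.mem_range_self i⟩ := fun i =>
      Subtype.ext ((e1 _ _).1 (Set.mem_range_self (f := g) i).choose_spec)
    have hbij : Function.Bijective f := by
      constructor
      · rintro ⟨_, i, rfl⟩ ⟨_, j, rfl⟩ hij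
        rw [hf, hf] at hij
        exact Subtype.ext ((e1 i j).2 (congrArg Subtype.val hij))
      · rintro ⟨_, i, rfl⟩
        exact ⟨_, hf i⟩
    refine ⟨⟨Equiv.ofBijective f hbij, ?_⟩, hf⟩
    rintro ⟨_, i, rfl⟩ ⟨_, j, rfl⟩
    simp only [Equiv.ofBijective_apply, hf]
    exact (e2 i j).symm
  · rintro ⟨φ, hφ⟩
    funext i j
    refine Prod.ext (propext ?_) (propext ?_)
    · have := φ.injective.eq_iff (a := ⟨g i, Set.mem_range_self i⟩)
        (b := ⟨g j, Set.mem_range_self j⟩)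
      rw [hφ, hφ] at this
      simp only [Subtype.mk.injEq] at this
      exact this.symm
    · have := φ.map_adj_iff (v := ⟨g i, Set.mem_range_self i⟩) (w := ⟨g j, Set.mem_range_self j⟩)
      rw [hφ, hφ] at this
      exact this.symm

open Classical in
/-- The vertices that `k`-WL on a graph substitutes into a tuple: all vertices, except that for
`k = 1` only the neighbors of the (single) entry of the tuple are taken. -/
noncomputable def graphWLRange {V : Type} [Fintype V] (Γ : SimpleGraph V) {k : ℕ}
    (g : Fin k → V) : Finset V :=
  if k = 1 then Finset.univ.filter (fun x => ∀ j, Γ.Adj (g j) x) else Finset.univ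

/-- The `i`-th coloring of the `k`-dimensional Weisfeiler-Leman algorithm on a graph. -/
noncomputable def graphWL {V : Type} [Fintype V] (Γ : SimpleGraph V) (k i : ℕ) :
    (Fin k → V) → WLColor (Fin k → Fin k → Prop × Prop) k i :=
  wlColoring (graphWLRange Γ) (graphInitialColor Γ) i

/-- Two graphs are not distinguished by `k`-WL: some bijection between their `k`-tuples
preserves the colors in all rounds (so also in the round in which the colorings are stable). -/
def GraphWLEquiv (k : ℕ) {V W : Type} [Fintype V] [Fintype W]
    (Γ : SimpleGraph V) (Δ : SimpleGraph W) : Prop :=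
  ∃ f : (Fin k → V) ≃ (Fin k → W), ∀ g i, graphWL Γ k i g = graphWL Δ k i (f g)

/-! ### Groups -/

/-- The initial color (Version II) of a `k`-tuple of group elements: its marked isomorphism type,
recorded as the group of all words in `k` letters that the tuple satisfies. -/
def groupInitialColor {G : Type} [Group G] {k : ℕ} (g : Fin k → G) :
    Subgroup (FreeGroup (Fin k)) :=
  (FreeGroup.lift g).ker

/-- Two tuples get the same initial color exactly if mapping one to the other, entry by entry,
extends to an isomorphism of the generated subgroups. -/
theorem groupInitialColor_eq_iff {G H : Type} [Group G] [Group H] {k : ℕ}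
    (g : Fin k → G) (h : Fin k → H) :
    groupInitialColor g = groupInitialColor h ↔
      ∃ φ : Subgroup.closure (Set.range g) ≃* Subgroup.closure (Set.range h),
        ∀ i, φ ⟨g i, Subgroup.subset_closure (Set.mem_range_self i)⟩ =
          ⟨h i, Subgroup.subset_closure (Set.mem_range_self i)⟩ := by
  constructor
  · intro e
    let a := QuotientGroup.quotientKerEquivRange (FreeGroup.lift g)
    let b := QuotientGroup.quotientKerEquivRange (FreeGroup.lift h)
    let m : (FreeGroup (Fin k) ⧸ (FreeGroup.lift g).ker) ≃*
        (FreeGroup (Fin k) ⧸ (FreeGroup.lift h).ker) := QuotientGroup.quotientMulEquivOfEq e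
    let sg := MulEquiv.subgroupCongr (FreeGroup.range_lift_eq_closure (f := g))
    let sh := MulEquiv.subgroupCongr (FreeGroup.range_lift_eq_closure (f := h))
    refine ⟨sg.symm.trans (a.symm.trans (m.trans (b.trans sh))), fun i => ?_⟩
    have h1 : sg.symm ⟨g i, Subgroup.subset_closure (Set.mem_range_self i)⟩
        = a (QuotientGroup.mk (FreeGroup.of i)) := by
      apply Subtype.ext
      change g i = FreeGroup.lift g (FreeGroup.of i)
      simp
    simp only [MulEquiv.trans_apply, h1, MulEquiv.symm_apply_apply]
    apply Subtype.ext
    change FreeGroup.lift h (FreeGroup.of i) = h i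
    simp
  · rintro ⟨φ, hφ⟩
    let g' : Fin k → Subgroup.closure (Set.range g) :=
      fun i => ⟨g i, Subgroup.subset_closure (Set.mem_range_self i)⟩
    let h' : Fin k → Subgroup.closure (Set.range h) :=
      fun i => ⟨h i, Subgroup.subset_closure (Set.mem_range_self i)⟩
    have hg : FreeGroup.lift g = (Subgroup.subtype _).comp (FreeGroup.lift g') := by
      ext i; simp [g']
    have hh : FreeGroup.lift h = (Subgroup.subtype _).comp (FreeGroup.lift h') := by
      ext i; simp [h']
    have hm : FreeGroup.lift h' = φ.toMonoidHom.comp (FreeGroup.lift g') := by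
      ext i; simp [g', h', hφ]
    ext w
    simp only [groupInitialColor, MonoidHom.mem_ker, hg, hh, hm, MonoidHom.comp_apply,
      Subgroup.coe_subtype, OneMemClass.coe_eq_one]
    exact (map_eq_one_iff φ φ.injective).symm

/-- The `i`-th coloring of the `k`-dimensional Weisfeiler-Leman algorithm, Version II, on a
group. -/
def groupWL (G : Type) [Group G] [Fintype G] (k i : ℕ) :
    (Fin k → G) → WLColor (Subgroup (FreeGroup (Fin k))) k i :=
  wlColoring (fun _ => Finset.univ) groupInitialColor i

/-- Two groups are not distinguished by `k`-WL, Version II: some bijection between their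
`k`-tuples preserves the colors in all rounds (so also in the round in which the colorings are
stable). -/
def GroupWLEquiv (k : ℕ) (G H : Type) [Group G] [Group H] [Fintype G] [Fintype H] : Prop :=
  ∃ f : (Fin k → G) ≃ (Fin k → H), ∀ g i, groupWL G k i g = groupWL H k i (f g)

/-- The (Version II) Weisfeiler-Leman dimension of the finite group `G` is at most `k`: `k`-WL
distinguishes `G` from every finite group that is not isomorphic to it. -/
def GroupWLDimLE (k : ℕ) (G : Type) [Group G] [Fintype G] : Prop :=
  ∀ (H : Type) [Group H] [Fintype H], GroupWLEquiv k G H → Nonempty (G ≃* H)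

/-! ## Group invariants -/

/-- The graph on the elements of `G` in which distinct elements are adjacent if their commutator is
trivial. -/
def commutingGraph (G : Type) [Group G] : SimpleGraph G where
  Adj a b := a ≠ b ∧ a * b * a⁻¹ * b⁻¹ = 1
  symm := ⟨fun a b h => ⟨h.1.symm, by
    have h2 : a * b = b * a := by
      have := h.2
      rwa [mul_inv_eq_one, mul_inv_eq_iff_eq_mul] at this
    rw [mul_inv_eq_one, mul_inv_eq_iff_eq_mul, h2]⟩⟩
  loopless := ⟨fun _ h => h.1 rfl⟩

/-- The `k`-generated subgroups of `G`. -/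
def KGeneratedSubgroup (k : ℕ) (G : Type) [Group G] : Type :=
  {S : Subgroup G // ∃ g : Fin k → G, Subgroup.closure (Set.range g) = S}

/-- `G` and `H` have equal `k`-profiles: the multisets of isomorphism types of their
`k`-generated subgroups agree. -/
def EqualProfiles (k : ℕ) (G H : Type) [Group G] [Group H] : Prop :=
  ∃ f : KGeneratedSubgroup k G ≃ KGeneratedSubgroup k H, ∀ S, Nonempty (S.1 ≃* (f S).1)

/-- The multisets of the sizes of the conjugacy classes of `G` and of `H` agree. -/
def EqualConjClassSizes (G H : Type) [Group G] [Group H] : Prop :=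
  ∃ f : ConjClasses G ≃ ConjClasses H, ∀ c, Nat.card c.carrier = Nat.card (f c).carrier

/-- `G` has nilpotency class exactly `2`. -/
def HasClassTwo (G : Type) [Group G] : Prop :=
  ∃ _ : Group.IsNilpotent G, Group.nilpotencyClass G = 2

/-! ## Bijections from fiber counts -/

/-! Let F be the field of order p^d with d ≥ 7 prime. The pairs are `PencilGroup p T` and
`PencilGroup p T'` for suitable T, T' outside the prime field; their order is n = p^(2d+2), so d is
of the order of log n.

Commuting graphs: two elements commute iff x.a * y.b = y.a * x.b. This survives rescaling b by a
factor depending only on (r, s), so the graph does not depend on T up to isomorphism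
(`nonempty_commutingGraph_iso`). This settles all dimensions l at once, and the class sizes as well.

Profiles: the marked isomorphism type of a k-tuple is governed by r, s and the relations, with
coefficients in the span of 1 and T, among its 2k entries b and c. The number of solutions of a
system of such relations depends on the rank of a matrix pencil A + T B. Minors have degree at most
2k in T, so all T of degree above 2k give the same rank, and Möbius inversion turns equal counts
into a bijection (`exists_equiv_pencilSum_eq_zero`, `equalProfiles`).

Dimension: on the center, [e₁, x] ↦ [e₂, x] is multiplication by T. With six entries,
Weisfeiler-Leman can evaluate polynomials in this operator by Horner's scheme, hence can see that
the minimal polynomial of T kills it (`exists_sim_aeval`). In an indistinguishable group the center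
is then an F-space, which yields an embedded copy of the pencil group, and equal orders finish
(`nonempty_mulEquiv`, `groupWLDimLE`).

Non-isomorphism: an isomorphism makes some fractional linear image of T' over the prime field a
conjugate of T. Only about p^4 d elements T' are of this kind, fewer than p^d
(`exists_isEmpty_mulEquiv`). -/

theorem exists_equiv_of_card_fiber_eq {X Y C : Type*} [Finite X] [Finite Y] (f : X → C) (g : Y → C)
    (h : ∀ c, Nat.card {x // f x = c} = Nat.card {y // g y = c}) :
    ∃ e : X ≃ Y, ∀ x, g (e x) = f x := by
  have e (c : C) : {x // f x = c} ≃ {y // g y = c} := (Finite.card_eq.1 (h c)).some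
  refine ⟨(Equiv.sigmaFiberEquiv f).symm.trans
    ((Equiv.sigmaCongrRight e).trans (Equiv.sigmaFiberEquiv g)), fun x => ?_⟩
  exact (e (f x) ⟨x, rfl⟩).2

/-- The fibers of two set-valued functions have the same sizes if the numbers of points with
large values agree. -/
theorem card_fiber_eq_of_card_subset_eq {X Y A : Type} [Finite X] [Finite Y] [Finite A]
    (f : X → Set A) (g : Y → Set A)
    (h : ∀ R : Set A, Nat.card {x // R ⊆ f x} = Nat.card {y // R ⊆ g y}) (R : Set A) :
    Nat.card {x // f x = R} = Nat.card {y // g y = R} := by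
  -- Möbius inversion from the top of the powerset: the points with value R are those with value
  -- containing R minus those with strictly larger value, and the latter are counted by induction.
  induction R using WellFoundedGT.induction with
  | ind R ih =>
  have key : ∀ {Z : Type} [Finite Z] (φ : Z → Set A), Nat.card {z // R ⊆ φ z} =
      Nat.card {z // φ z = R} + Nat.card {z // R ⊂ φ z} := by
    intro Z _ φ
    classical
    rw [← Nat.card_sum]
    refine Nat.card_congr ((Equiv.subtypeEquivRight fun z => ?_).trans
      (subtypeOrEquiv _ _ ?_))
    · rw [Set.ssubset_iff_subset_ne]
      constructor
      · intro hz
        by_cases e : φ z = R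
        · exact Or.inl e
        · exact Or.inr ⟨hz, fun e' => e e'.symm⟩
      · rintro (rfl | hz)
        exacts [subset_rfl, hz.1]
    · rw [disjoint_iff_inf_le]
      rintro z ⟨h1, h2⟩
      exact h2.ne h1.symm
  have key2 : ∀ {Z : Type} [Finite Z] (φ : Z → Set A), Nat.card {z // R ⊂ φ z} =
      ∑ᶠ S : {S : Set A // R ⊂ S}, Nat.card {z // φ z = S} := by
    intro Z _ φ
    have := Fintype.ofFinite {S : Set A // R ⊂ S}
    rw [finsum_eq_sum_of_fintype, ← Nat.card_sigma]
    refine Nat.card_congr ⟨fun z => ⟨⟨φ z, z.2⟩, ⟨z, rfl⟩⟩,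
      fun z => ⟨z.2, by rw [z.2.2]; exact z.1.2⟩, fun z => rfl, ?_⟩
    rintro ⟨⟨S, hS⟩, ⟨z, hz⟩⟩
    dsimp only at hz
    subst hz
    rfl
  have h1 := h R
  rw [key f, key g, key2 f, key2 g, finsum_congr fun S : {S : Set A // R ⊂ S} => ih S.1 S.2] at h1
  exact Nat.add_right_cancel h1

/-! ## The Weisfeiler-Leman refinement -/

section

variable {G H : Type} [Group G] [Group H] [Fintype G] [Fintype H] {k : ℕ}

/-- The tuples `g` and `h` are not distinguished by Version II of the Weisfeiler-Leman
algorithm. -/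
def GroupWLSim (g : Fin k → G) (h : Fin k → H) : Prop :=
  ∀ i, groupWL G k i g = groupWL H k i h

theorem GroupWLSim.symm {g : Fin k → G} {h : Fin k → H} (s : GroupWLSim g h) : GroupWLSim h g :=
  fun i => (s i).symm

theorem groupWL_eq_of_le {g : Fin k → G} {h : Fin k → H} {i j : ℕ} (hij : i ≤ j)
    (e : groupWL G k j g = groupWL H k j h) : groupWL G k i g = groupWL H k i h := by
  induction hij with
  | refl => exact e
  | step _ ih => exact ih (congrArg Prod.fst e)

theorem GroupWLSim.lift_eq_one_iff {g : Fin k → G} {h : Fin k → H} (s : GroupWLSim g h)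
    (w : FreeGroup (Fin k)) : FreeGroup.lift g w = 1 ↔ FreeGroup.lift h w = 1 := by
  have := s 0
  change (FreeGroup.lift g).ker = (FreeGroup.lift h).ker at this
  rw [← MonoidHom.mem_ker, this, MonoidHom.mem_ker]

/-- The next color provides a y for each single round. One y works for all rounds: otherwise take a
round of failure for each of the finitely many y; colors only refine, so no y would survive the
latest of these. The same y serves every position j because the members of the multiset are whole
tuples of colors. -/
theorem GroupWLSim.exists_update {g : Fin k → G} {h : Fin k → H} (s : GroupWLSim g h) (x : G) :
    ∃ y, ∀ j, GroupWLSim (Function.update g j x) (Function.update h j y) := by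
  have step : ∀ i, ∃ y, ∀ j, groupWL G k i (Function.update g j x) =
      groupWL H k i (Function.update h j y) := by
    intro i
    have e : Finset.univ.val.map (fun x j => groupWL G k i (Function.update g j x)) =
      Finset.univ.val.map (fun y j => groupWL H k i (Function.update h j y)) :=
      congrArg Prod.snd (s (i + 1))
    have hx : (fun j => groupWL G k i (Function.update g j x)) ∈
        Finset.univ.val.map (fun x j => groupWL G k i (Function.update g j x)) :=
      Multiset.mem_map_of_mem _ (Finset.mem_univ x)
    rw [e, Multiset.mem_map] at hx
    obtain ⟨y, -, hy⟩ := hx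
    exact ⟨y, fun j => (congrFun hy j).symm⟩
  by_contra! hc
  have hc' : ∀ y, ∃ i, ∃ j, groupWL G k i (Function.update g j x) ≠
      groupWL H k i (Function.update h j y) := fun y => by
    obtain ⟨j, hj⟩ := hc y
    obtain ⟨i, hi⟩ := not_forall.1 hj
    exact ⟨i, j, hi⟩
  choose i hi using hc'
  obtain ⟨y, hy⟩ := step (Finset.univ.sup i)
  obtain ⟨j, hj⟩ := hi y
  exact hj (groupWL_eq_of_le (Finset.le_sup (Finset.mem_univ y)) (hy j))

theorem GroupWLEquiv.card_eq (hk : k ≠ 0) (e : GroupWLEquiv k G H) :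
    Fintype.card G = Fintype.card H := by
  obtain ⟨f, -⟩ := e
  have := Fintype.card_congr f
  simp only [Fintype.card_fun, Fintype.card_fin] at this
  exact Nat.pow_left_injective hk this

end

theorem GraphWLEquiv.of_iso {V W : Type} [Fintype V] [Fintype W] {Γ : SimpleGraph V}
    {Δ : SimpleGraph W} (φ : Γ ≃g Δ) (k : ℕ) : GraphWLEquiv k Γ Δ := by
  refine ⟨Equiv.arrowCongr (Equiv.refl _) φ.toEquiv, fun g i => ?_⟩
  induction i generalizing g with
  | zero =>
    funext a b
    refine Prod.ext (propext ?_) (propext ?_)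
    · exact φ.injective.eq_iff.symm
    · exact φ.map_adj_iff.symm
  | succ i ih =>
    refine Prod.ext (ih g) ?_
    have hN : graphWLRange Δ (φ ∘ g) = (graphWLRange Γ g).map φ.toEquiv.toEmbedding := by
      ext x
      obtain ⟨x, rfl⟩ := φ.surjective x
      have hx : φ x ∈ (graphWLRange Γ g).map φ.toEquiv.toEmbedding ↔ x ∈ graphWLRange Γ g :=
        Finset.mem_map' (f := φ.toEquiv.toEmbedding)
      rw [hx]
      unfold graphWLRange
      split_ifs <;> simp [φ.map_adj_iff]
    change (graphWLRange Γ g).val.map _ = (graphWLRange Δ (φ ∘ g)).val.map _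
    rw [hN, Finset.map_val, Multiset.map_map]
    refine Multiset.map_congr rfl fun x _ => funext fun j => ?_
    refine (ih (Function.update g j x)).trans ?_
    change wlColoring _ _ _ (φ ∘ Function.update g j x) = _
    rw [Function.comp_update]
    rfl

/-! ## Conjugacy class sizes and the commuting graph -/

theorem commutingGraph_adj_iff {G : Type} [Group G] {a b : G} :
    (commutingGraph G).Adj a b ↔ a ≠ b ∧ Commute a b := by
  change a ≠ b ∧ a * b * a⁻¹ * b⁻¹ = 1 ↔ _
  rw [mul_inv_eq_one, mul_inv_eq_iff_eq_mul]
  rfl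

theorem card_carrier_mul_card_commute {G : Type} [Group G] [Finite G] (g : G) :
    Nat.card (ConjClasses.mk g).carrier * Nat.card {x // Commute x g} = Nat.card G := by
  refine Eq.trans ?_ (Nat.card_congr (MulAction.orbitProdStabilizerEquivGroup (ConjAct G) g))
  rw [Nat.card_prod]
  congr 1
  · rw [ConjAct.orbit_eq_carrier_conjClasses]
  · refine Nat.card_congr ((ConjAct.ofConjAct (G := G)).toEquiv.symm.subtypeEquiv fun x => ?_)
    rw [MulAction.mem_stabilizer_iff, ConjAct.smul_def]
    exact (mul_inv_eq_iff_eq_mul (a := x * g) (b := x) (c := g)).symm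

/-- The graph determines the orders of the centralizers, hence the class size of each element. The
classes of size s cover s times as many elements as there are classes; dividing by s counts the
classes, and s = 0 does not occur. -/
theorem EqualConjClassSizes.of_commutingGraph_iso {G H : Type} [Group G] [Group H] [Finite G]
    [Finite H] (φ : commutingGraph G ≃g commutingGraph H) : EqualConjClassSizes G H := by
  have hc : ∀ x g, Commute x g ↔ Commute (φ x) (φ g) := by
    intro x g
    have h := φ.map_adj_iff (v := x) (w := g)
    rw [commutingGraph_adj_iff, commutingGraph_adj_iff, φ.injective.ne_iff] at h
    by_cases e : x = g
    · subst e
      exact ⟨fun _ => .refl _, fun _ => .refl _⟩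
    · simpa [e] using h.symm
  have hs : ∀ g, Nat.card (ConjClasses.mk g).carrier =
      Nat.card (ConjClasses.mk (φ g)).carrier := by
    intro g
    have h1 := card_carrier_mul_card_commute g
    have h2 := card_carrier_mul_card_commute (φ g)
    have e : Nat.card {x // Commute x g} = Nat.card {x // Commute x (φ g)} :=
      Nat.card_congr (φ.toEquiv.subtypeEquiv fun x => hc x g)
    have pos : 0 < Nat.card {x // Commute x g} := Nat.card_pos_iff.2 ⟨⟨g, .refl g⟩, inferInstance⟩
    rw [← e, ← Nat.card_congr φ.toEquiv, ← h1] at h2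
    exact (Nat.eq_of_mul_eq_mul_right pos h2).symm
  have count : ∀ (K : Type) [Group K] [Finite K] (s : ℕ),
      Nat.card {g : K // Nat.card (ConjClasses.mk g).carrier = s} =
        Nat.card {c : ConjClasses K // Nat.card c.carrier = s} * s := by
    intro K _ _ s
    have := Fintype.ofFinite {c : ConjClasses K // Nat.card c.carrier = s}
    have e : {g : K // Nat.card (ConjClasses.mk g).carrier = s} ≃
        Σ c : {c : ConjClasses K // Nat.card c.carrier = s}, c.1.carrier :=
      { toFun g := ⟨⟨_, g.2⟩, g.1, ConjClasses.mem_carrier_mk⟩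
        invFun x := ⟨x.2.1, by rw [ConjClasses.mem_carrier_iff_mk_eq.1 x.2.2]; exact x.1.2⟩
        left_inv _ := rfl
        right_inv := by
          rintro ⟨⟨c, hc⟩, ⟨x, hx⟩⟩
          have hx' := ConjClasses.mem_carrier_iff_mk_eq.1 hx
          subst hx'
          rfl }
    rw [Nat.card_congr e, Nat.card_sigma, Finset.sum_congr rfl fun c _ => c.2]
    rw [Finset.sum_const, Finset.card_univ, Nat.card_eq_fintype_card, smul_eq_mul]
  obtain ⟨f, hf⟩ := exists_equiv_of_card_fiber_eq (fun c : ConjClasses G => Nat.card c.carrier)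
    (fun c : ConjClasses H => Nat.card c.carrier) fun s => by
      rcases Nat.eq_zero_or_pos s with rfl | hpos
      · have none : ∀ (K : Type) [Group K] [Finite K],
            IsEmpty {c : ConjClasses K // Nat.card c.carrier = 0} := by
          intro K _ _
          refine ⟨fun ⟨c, hc⟩ => ?_⟩
          obtain ⟨g, rfl⟩ := ConjClasses.exists_rep c
          have : Nonempty (ConjClasses.mk g).carrier := ⟨⟨g, ConjClasses.mem_carrier_mk⟩⟩
          exact Nat.card_pos.ne' hc
        have := none G
        have := none H
        rw [Nat.card_of_isEmpty, Nat.card_of_isEmpty]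
      · refine Nat.eq_of_mul_eq_mul_right hpos ?_
        rw [← count, ← count]
        exact Nat.card_congr (φ.toEquiv.subtypeEquiv fun g => by rw [hs]; rfl)
  exact ⟨f, fun c => (hf c).symm⟩

/-! ## The groups -/

/-- The linear form `r + s T`. -/
def linForm {p : ℕ} {F : Type} [Field F] [Algebra (ZMod p) F] (T : F) (r s : ZMod p) : F :=
  algebraMap (ZMod p) F r + algebraMap (ZMod p) F s * T

/-- The group of the unitriangular `3 × 3`-matrices over `F` with rows `(1, a, c)`, `(0, 1, b)`
and `(0, 0, 1)`, where `a = r + s T` lies in the span of `1` and `T` over the prime field. -/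
@[ext]
structure PencilGroup (p : ℕ) {F : Type} (T : F) where
  r : ZMod p
  s : ZMod p
  b : F
  c : F

namespace PencilGroup

variable {p : ℕ} {F : Type} {T : F}

/-- The coordinates of an element. -/
def equivProd (p : ℕ) {F : Type} (T : F) : PencilGroup p T ≃ (ZMod p × ZMod p) × F × F where
  toFun x := ((x.r, x.s), x.b, x.c)
  invFun x := ⟨x.1.1, x.1.2, x.2.1, x.2.2⟩

instance [NeZero p] [Finite F] : Finite (PencilGroup p T) := Finite.of_equiv _ (equivProd p T).symm

noncomputable instance [NeZero p] [Finite F] : Fintype (PencilGroup p T) := Fintype.ofFinite _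

theorem natCard [NeZero p] : Nat.card (PencilGroup p T) = p ^ 2 * Nat.card F ^ 2 := by
  rw [Nat.card_congr (equivProd p T)]
  simp [sq]

variable [Field F]

instance : One (PencilGroup p T) := ⟨⟨0, 0, 0, 0⟩⟩

@[simp] theorem one_r : (1 : PencilGroup p T).r = 0 := rfl
@[simp] theorem one_s : (1 : PencilGroup p T).s = 0 := rfl
@[simp] theorem one_b : (1 : PencilGroup p T).b = 0 := rfl
@[simp] theorem one_c : (1 : PencilGroup p T).c = 0 := rfl

variable [Algebra (ZMod p) F]

/-- The matrix entry `r + s T`. -/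
def a (x : PencilGroup p T) : F := linForm T x.r x.s

instance : Mul (PencilGroup p T) := ⟨fun x y => ⟨x.r + y.r, x.s + y.s, x.b + y.b,
  x.c + y.c + x.a * y.b⟩⟩

instance : Inv (PencilGroup p T) := ⟨fun x => ⟨-x.r, -x.s, -x.b, -x.c + x.a * x.b⟩⟩

@[simp] theorem mul_r (x y : PencilGroup p T) : (x * y).r = x.r + y.r := rfl
@[simp] theorem mul_s (x y : PencilGroup p T) : (x * y).s = x.s + y.s := rfl
@[simp] theorem mul_b (x y : PencilGroup p T) : (x * y).b = x.b + y.b := rfl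
@[simp] theorem mul_c (x y : PencilGroup p T) : (x * y).c = x.c + y.c + x.a * y.b := rfl
@[simp] theorem inv_r (x : PencilGroup p T) : x⁻¹.r = -x.r := rfl
@[simp] theorem inv_s (x : PencilGroup p T) : x⁻¹.s = -x.s := rfl
@[simp] theorem inv_b (x : PencilGroup p T) : x⁻¹.b = -x.b := rfl
@[simp] theorem inv_c (x : PencilGroup p T) : x⁻¹.c = -x.c + x.a * x.b := rfl

@[simp] theorem mul_a (x y : PencilGroup p T) : (x * y).a = x.a + y.a := by
  simp only [a, linForm, mul_r, mul_s, map_add]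
  ring

@[simp] theorem one_a : (1 : PencilGroup p T).a = 0 := by
  simp [a, linForm]

@[simp] theorem inv_a (x : PencilGroup p T) : x⁻¹.a = -x.a := by
  simp only [a, linForm, inv_r, inv_s, map_neg]
  ring

instance : Group (PencilGroup p T) := Group.ofLeftAxioms
  (fun x y z => by
    refine PencilGroup.ext (add_assoc _ _ _) (add_assoc _ _ _) (add_assoc _ _ _) ?_
    simp only [mul_c, mul_a, mul_b]
    ring)
  (fun x => by
    refine PencilGroup.ext (zero_add _) (zero_add _) (zero_add _) ?_
    simp)
  (fun x => by
    refine PencilGroup.ext (neg_add_cancel _) (neg_add_cancel _) (neg_add_cancel _) ?_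
    simp)

theorem commutator_eq (x y : PencilGroup p T) :
    x * y * x⁻¹ * y⁻¹ = ⟨0, 0, 0, x.a * y.b - y.a * x.b⟩ := by
  refine PencilGroup.ext (by simp) (by simp) (by simp) ?_
  simp only [mul_c, inv_c, mul_a, inv_a, inv_b]
  ring

theorem commute_iff {x y : PencilGroup p T} : Commute x y ↔ x.a * y.b = y.a * x.b := by
  rw [commute_iff_eq, ← mul_inv_eq_iff_eq_mul, ← mul_inv_eq_one, commutator_eq,
    ← sub_eq_zero (a := x.a * y.b)]
  exact ⟨fun h => congrArg PencilGroup.c h, fun h => PencilGroup.ext rfl rfl rfl h⟩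

theorem pow_eq (x : PencilGroup p T) (n : ℕ) :
    x ^ n = ⟨n * x.r, n * x.s, n * x.b, n * x.c + n.choose 2 * (x.a * x.b)⟩ := by
  induction n with
  | zero => ext <;> simp
  | succ n ih =>
    have ha : (⟨n * x.r, n * x.s, n * x.b, n * x.c + n.choose 2 * (x.a * x.b)⟩ :
        PencilGroup p T).a = n * x.a := by
      simp only [a, linForm, map_mul, map_natCast]
      ring
    rw [pow_succ, ih]
    refine PencilGroup.ext ?_ ?_ ?_ ?_
    · simp [add_mul]
    · simp [add_mul]
    · simp [add_mul]
    · simp only [mul_c, ha, Nat.choose_succ_succ' n 1, Nat.choose_one_right]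
      push_cast
      ring

/-- The noncommutative correction in `pow_eq` has the coefficient `p.choose 2`, which p divides
because p is odd. -/
theorem pow_prime [hp : Fact p.Prime] (h2 : p ≠ 2) (x : PencilGroup p T) : x ^ p = 1 := by
  have hF : ∀ n : ℕ, p ∣ n → (n : F) = 0 := fun n hn => by
    rw [← map_natCast (algebraMap (ZMod p) F), (ZMod.natCast_eq_zero_iff n p).2 hn, map_zero]
  have hc : p ∣ p.choose 2 := hp.out.dvd_choose_self (by norm_num)
    (lt_of_le_of_ne hp.out.two_le h2.symm)
  rw [pow_eq, hF p dvd_rfl, hF _ hc]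
  ext <;> simp

theorem exponent_eq [hp : Fact p.Prime] (h2 : p ≠ 2) :
    Monoid.exponent (PencilGroup p T) = p := by
  refine (hp.out.eq_one_or_self_of_dvd _
    (Monoid.exponent_dvd_of_forall_pow_eq_one (pow_prime h2))).resolve_left fun h => ?_
  have h1 := Monoid.pow_exponent_eq_one (⟨0, 0, 1, 0⟩ : PencilGroup p T)
  rw [h, pow_one] at h1
  exact one_ne_zero (congrArg PencilGroup.b h1)

theorem hasClassTwo [Fact p.Prime] : HasClassTwo (PencilGroup p T) := by
  have hcomm : ∀ x y z : PencilGroup p T, Commute (x * y * x⁻¹ * y⁻¹) z := fun x y z => by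
    rw [commute_iff, commutator_eq]
    simp [a, linForm]
  have h2 : Subgroup.upperCentralSeries (PencilGroup p T) 2 = ⊤ := by
    rw [eq_top_iff]
    intro x _
    rw [Subgroup.mem_upperCentralSeries_succ_iff]
    intro y
    rw [Subgroup.upperCentralSeries_one, Subgroup.mem_center_iff]
    exact fun z => (hcomm x y z).symm
  have hn : Group.IsNilpotent (PencilGroup p T) := ⟨2, h2⟩
  refine ⟨hn, le_antisymm (Subgroup.upperCentralSeries_eq_top_iff_nilpotencyClass_le.1 h2) ?_⟩
  by_contra! hlt
  have h1 := Subgroup.upperCentralSeries_eq_top_iff_nilpotencyClass_le.2 (Nat.le_of_lt_succ hlt)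
  rw [Subgroup.upperCentralSeries_one] at h1
  have := Subgroup.mem_center_iff.1 (h1 ▸ Subgroup.mem_top (⟨1, 0, 0, 0⟩ : PencilGroup p T))
    ⟨0, 0, 1, 0⟩
  have := commute_iff.1 (show Commute _ _ from this)
  simp [a, linForm] at this

end PencilGroup

/-- If `T` lies outside the prime field, then the form `r + s T` vanishes only trivially. -/
theorem linForm_eq_zero {p : ℕ} [Fact p.Prime] {F : Type} [Field F] [Algebra (ZMod p) F] {T : F}
    (hT : T ∉ Set.range (algebraMap (ZMod p) F)) {r s : ZMod p} (h : linForm T r s = 0) :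
    r = 0 ∧ s = 0 := by
  have hs : s = 0 := by
    by_contra hs
    refine hT ⟨-r / s, ?_⟩
    have : algebraMap (ZMod p) F s ≠ 0 := by simpa using hs
    rw [map_div₀, map_neg, div_eq_iff this]
    unfold linForm at h
    linear_combination -h
  subst hs
  simpa [linForm] using h

namespace PencilGroup

variable {p : ℕ} [Fact p.Prime] {F : Type} [Field F] [Algebra (ZMod p) F]

/-- The commuting graphs of the groups belonging to two elements outside the prime field are
isomorphic. -/
theorem nonempty_commutingGraph_iso {T T' : F} (hT : T ∉ Set.range (algebraMap (ZMod p) F))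
    (hT' : T' ∉ Set.range (algebraMap (ZMod p) F)) :
    Nonempty (commutingGraph (PencilGroup p T) ≃g commutingGraph (PencilGroup p T')) := by
  classical
  -- The factor is a'/a, so that a' = m a and both sides of the commutation equation acquire the
  -- factor m(x) m(y). Where a = 0, any nonzero factor would do.
  let m : ZMod p → ZMod p → F := fun r s =>
    if linForm T r s = 0 then 1 else linForm T' r s / linForm T r s
  have hm : ∀ r s, m r s ≠ 0 ∧ linForm T' r s = m r s * linForm T r s := by
    intro r s
    by_cases h : linForm T r s = 0
    · obtain ⟨rfl, rfl⟩ := linForm_eq_zero hT h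
      simp [m, linForm]
    · have h' : linForm T' r s ≠ 0 := fun h' => h (by
        obtain ⟨rfl, rfl⟩ := linForm_eq_zero hT' h'
        simp [linForm])
      simp only [m, if_neg h]
      exact ⟨div_ne_zero h' h, by field_simp⟩
  let e : PencilGroup p T ≃ PencilGroup p T' :=
    { toFun x := ⟨x.r, x.s, m x.r x.s * x.b, x.c⟩
      invFun x := ⟨x.r, x.s, (m x.r x.s)⁻¹ * x.b, x.c⟩
      left_inv x := by ext <;> simp [(hm x.r x.s).1]
      right_inv x := by ext <;> simp [(hm x.r x.s).1] }
  refine ⟨⟨e, fun {x y} => ?_⟩⟩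
  rw [commutingGraph_adj_iff, commutingGraph_adj_iff, e.injective.ne_iff, commute_iff,
    commute_iff]
  refine and_congr_right fun _ => ?_
  change linForm T' x.r x.s * (m y.r y.s * y.b) = linForm T' y.r y.s * (m x.r x.s * x.b) ↔
    x.a * y.b = y.a * x.b
  rw [(hm x.r x.s).2, (hm y.r y.s).2]
  have h := mul_ne_zero (hm x.r x.s).1 (hm y.r y.s).1
  rw [← mul_right_inj' h (b := x.a * y.b)]
  unfold a
  constructor <;> intro h <;> linear_combination h

end PencilGroup

/-! ## Profiles -/

section

variable {k : ℕ}

/-- The set of marked isomorphism types of the generating `k`-tuples of a group, together with the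
number of these tuples. -/
noncomputable def generatingColor (k : ℕ) (G : Type) [Group G] :
    Set (Subgroup (FreeGroup (Fin k))) × ℕ :=
  (groupInitialColor '' {g : Fin k → G | Subgroup.closure (Set.range g) = ⊤},
    Nat.card {g : Fin k → G // Subgroup.closure (Set.range g) = ⊤})

theorem groupInitialColor_comp {G H : Type} [Group G] [Group H] (φ : G →* H)
    (hφ : Function.Injective φ) (g : Fin k → G) :
    groupInitialColor (φ ∘ g) = groupInitialColor g := by
  have : FreeGroup.lift (φ ∘ g) = φ.comp (FreeGroup.lift g) := by
    ext i
    simp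
  ext w
  simp only [groupInitialColor, this, MonoidHom.mem_ker, MonoidHom.comp_apply]
  exact map_eq_one_iff φ hφ

theorem closure_range_comp {G H : Type} [Group G] [Group H] (φ : G →* H) (g : Fin k → G) :
    Subgroup.closure (Set.range (φ ∘ g)) = (Subgroup.closure (Set.range g)).map φ := by
  rw [Set.range_comp, MonoidHom.map_closure]

theorem closure_range_mulEquiv_comp {G H : Type} [Group G] [Group H] (φ : G ≃* H)
    (g : Fin k → G) : Subgroup.closure (Set.range g) = ⊤ ↔
      Subgroup.closure (Set.range (φ ∘ g)) = ⊤ := by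
  have := closure_range_comp φ.toMonoidHom g
  change Subgroup.closure (Set.range (φ ∘ g)) = _ at this
  rw [this, ← Subgroup.map_top_of_surjective φ.toMonoidHom φ.surjective]
  exact ⟨fun h => by rw [h], fun h => Subgroup.map_injective φ.injective h⟩

theorem generatingColor_congr {G H : Type} [Group G] [Group H] (φ : G ≃* H) :
    generatingColor k G = generatingColor k H := by
  refine Prod.ext ?_ (Nat.card_congr
    ((Equiv.arrowCongr (Equiv.refl _) φ.toEquiv).subtypeEquiv (closure_range_mulEquiv_comp φ)))
  have : ∀ {G H : Type} [Group G] [Group H], (G ≃* H) →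
      (generatingColor k G).1 ⊆ (generatingColor k H).1 := by
    rintro G H _ _ φ _ ⟨g, hg, rfl⟩
    exact ⟨φ ∘ g, (closure_range_mulEquiv_comp φ g).1 hg,
      groupInitialColor_comp φ.toMonoidHom φ.injective g⟩
  exact (this φ).antisymm (this φ.symm)

theorem closure_range_codRestrict {G : Type} [Group G] (S : Subgroup G) (g : Fin k → S) :
    Subgroup.closure (Set.range g) = ⊤ ↔ Subgroup.closure (Set.range (S.subtype ∘ g)) = S := by
  rw [closure_range_comp]
  constructor
  · intro h
    rw [h, ← MonoidHom.range_eq_map, Subgroup.range_subtype]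
  · intro h
    refine Subgroup.map_injective S.subtype_injective ?_
    rw [h, ← MonoidHom.range_eq_map, Subgroup.range_subtype]

theorem card_generating_subgroup {G : Type} [Group G] (S : Subgroup G) :
    Nat.card {g : Fin k → G // Subgroup.closure (Set.range g) = S} = (generatingColor k S).2 :=
  Nat.card_congr
    { toFun g := ⟨fun i => ⟨g.1 i,
          g.2.le (Subgroup.subset_closure (Set.mem_range_self i))⟩,
        (closure_range_codRestrict S _).2 g.2⟩
      invFun g := ⟨S.subtype ∘ g.1, (closure_range_codRestrict S _).1 g.2⟩
      left_inv _ := rfl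
      right_inv _ := rfl }

/-- A marked isomorphism type of a generating tuple determines the group, so `generatingColor`
separates isomorphism types of k-generated groups. -/
theorem nonempty_mulEquiv_of_generatingColor_eq {G H : Type} [Group G] [Group H]
    (h : generatingColor k G = generatingColor k H) (g : Fin k → G)
    (hg : Subgroup.closure (Set.range g) = ⊤) : Nonempty (G ≃* H) := by
  have : groupInitialColor g ∈ (generatingColor k G).1 := ⟨g, hg, rfl⟩
  rw [h] at this
  obtain ⟨g', hg', e⟩ := this
  obtain ⟨φ, -⟩ := (groupInitialColor_eq_iff g g').1 e.symm
  exact ⟨Subgroup.topEquiv.symm.trans ((MulEquiv.subgroupCongr hg.symm).trans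
    (φ.trans ((MulEquiv.subgroupCongr hg').trans Subgroup.topEquiv)))⟩

/-- The second component of the color is the number of k-tuples generating a given subgroup.
Division by it converts counts of tuples into counts of subgroups. -/
theorem card_tuples_generatingColor {G : Type} [Group G] [Finite G]
    (c : Set (Subgroup (FreeGroup (Fin k))) × ℕ) :
    Nat.card {g : Fin k → G // generatingColor k (Subgroup.closure (Set.range g)) = c} =
      Nat.card {S : KGeneratedSubgroup k G // generatingColor k S.1 = c} * c.2 := by
  have : Finite (KGeneratedSubgroup k G) := Subtype.finite
  have := Fintype.ofFinite {S : KGeneratedSubgroup k G // generatingColor k S.1 = c}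
  have e : {g : Fin k → G // generatingColor k (Subgroup.closure (Set.range g)) = c} ≃
      Σ S : {S : KGeneratedSubgroup k G // generatingColor k S.1 = c},
        {g : Fin k → G // Subgroup.closure (Set.range g) = S.1.1} :=
    { toFun g := ⟨⟨⟨_, g.1, rfl⟩, g.2⟩, g.1, rfl⟩
      invFun x := ⟨x.2.1, by rw [x.2.2]; exact x.1.2⟩
      left_inv _ := rfl
      right_inv := by
        rintro ⟨⟨⟨S, hS⟩, hc⟩, ⟨g, hg⟩⟩
        dsimp only at hg
        subst hg
        rfl }
  rw [Nat.card_congr e, Nat.card_sigma,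
    Finset.sum_congr rfl fun S _ => (card_generating_subgroup S.1.1).trans (congrArg Prod.snd S.2),
    Finset.sum_const, Finset.card_univ, Nat.card_eq_fintype_card, smul_eq_mul]

/-- Two groups have equal `k`-profiles if some bijection between their `k`-tuples preserves the
marked isomorphism types. -/
theorem EqualProfiles.of_equiv {G H : Type} [Group G] [Group H] [Finite G] [Finite H]
    (f : (Fin k → G) ≃ (Fin k → H)) (hf : ∀ g, groupInitialColor g = groupInitialColor (f g)) :
    EqualProfiles k G H := by
  have : Finite (KGeneratedSubgroup k G) := Subtype.finite
  have : Finite (KGeneratedSubgroup k H) := Subtype.finite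
  obtain ⟨e, he⟩ := exists_equiv_of_card_fiber_eq
    (fun S : KGeneratedSubgroup k G => generatingColor k S.1)
    (fun S : KGeneratedSubgroup k H => generatingColor k S.1) fun c => by
      -- Division by `c.2` needs it nonzero; a color recording no generating tuple is not that of a
      -- k-generated subgroup.
      rcases Nat.eq_zero_or_pos c.2 with h0 | hpos
      · have none : ∀ (K : Type) [Group K] [Finite K],
            IsEmpty {S : KGeneratedSubgroup k K // generatingColor k S.1 = c} := by
          refine fun K _ _ => ⟨fun ⟨S, hS⟩ => ?_⟩
          have : Nonempty {g : Fin k → K // Subgroup.closure (Set.range g) = S.1} :=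
            let ⟨g, hg⟩ := S.2; ⟨⟨g, hg⟩⟩
          refine (Nat.card_pos (α := {g : Fin k → K // Subgroup.closure (Set.range g) = S.1})).ne' ?_
          rw [card_generating_subgroup, hS, h0]
        have := none G
        have := none H
        rw [Nat.card_of_isEmpty, Nat.card_of_isEmpty]
      · refine Nat.eq_of_mul_eq_mul_right hpos ?_
        rw [← card_tuples_generatingColor, ← card_tuples_generatingColor]
        refine Nat.card_congr (f.subtypeEquiv fun g => ?_)
        obtain ⟨φ, -⟩ := (groupInitialColor_eq_iff g (f g)).1 (hf g)
        rw [generatingColor_congr φ]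
  refine ⟨e, fun S => ?_⟩
  obtain ⟨g, hg⟩ := S.2
  refine nonempty_mulEquiv_of_generatingColor_eq (he S).symm
    (fun i => ⟨g i, hg.le (Subgroup.subset_closure (Set.mem_range_self i))⟩) ?_
  exact (closure_range_codRestrict S.1 _).2 hg

end

/-! ## Linear relations with coefficients in a pencil -/

theorem Matrix.exists_submatrix_linearIndependent_row {K m n : Type*} [Field K] [Fintype m]
    [Fintype n] (M : Matrix m n K) :
    ∃ f : Fin M.rank → m, LinearIndependent K (M.submatrix f id).row := by
  obtain ⟨κ, f, hf, hs, hl⟩ := exists_linearIndependent' K M.row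
  have := Fintype.ofInjective f hf
  have hc : Fintype.card κ = M.rank := by
    rw [Matrix.rank_eq_finrank_span_row, ← hs, finrank_span_eq_card hl]
  exact ⟨f ∘ (Fintype.equivFinOfCardEq hc).symm, hl.comp _ (Equiv.injective _)⟩

open scoped Matrix in
theorem Matrix.exists_submatrix_det_ne_zero {K m n : Type*} [Field K] [Fintype m]
    [Fintype n] (M : Matrix m n K) :
    ∃ (f : Fin M.rank → m) (g : Fin M.rank → n), (M.submatrix f g).det ≠ 0 := by
  obtain ⟨f, hf⟩ := M.exists_submatrix_linearIndependent_row
  have hr : (M.submatrix f id)ᵀ.rank = M.rank := by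
    rw [Matrix.rank_transpose, hf.rank_matrix, Fintype.card_fin]
  obtain ⟨g, hg⟩ := (M.submatrix f id)ᵀ.exists_submatrix_linearIndependent_row
  refine ⟨f, g ∘ Fin.cast hr.symm, ?_⟩
  have hl := hg.comp (Fin.cast hr.symm) (Fin.cast_injective _)
  rw [← Matrix.det_transpose]
  exact ((Matrix.isUnit_iff_isUnit_det _).1 (Matrix.linearIndependent_rows_iff_isUnit.1 hl)).ne_zero

open Polynomial in
/-- The rank of a matrix pencil at a point of high degree is at least its rank at any other
point. -/
theorem rank_pencil_le {K F m n : Type*} [Field K] [Field F] [Algebra K F] [Fintype m] [Fintype n]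
    (A B : Matrix m n K) (T T' : F)
    (hT' : ∀ P : K[X], P ≠ 0 → P.natDegree ≤ Fintype.card n → aeval T' P ≠ 0) :
    (A.map (algebraMap K F) + T • B.map (algebraMap K F)).rank ≤
      (A.map (algebraMap K F) + T' • B.map (algebraMap K F)).rank := by
  set M := A.map (algebraMap K F) + T • B.map (algebraMap K F) with hM
  set M' := A.map (algebraMap K F) + T' • B.map (algebraMap K F) with hM'
  -- A nonzero minor of maximal size at T is the value at T of a nonzero polynomial D whose degree
  -- is at most the rank. By hypothesis D does not vanish at T', so the rank there is at least as
  -- large.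
  obtain ⟨f, g, hfg⟩ := M.exists_submatrix_det_ne_zero
  set D : K[X] := ((X : K[X]) • (B.submatrix f g).map C + (A.submatrix f g).map C).det with hD
  have hev : ∀ S : F, aeval S D =
      ((A.map (algebraMap K F) + S • B.map (algebraMap K F)).submatrix f g).det := by
    intro S
    rw [hD, AlgHom.map_det]
    congr 1
    ext i j
    simpa [add_comm] using mul_comm _ _
  have hD0 : D ≠ 0 := by
    intro h0
    have := hev T
    rw [h0, map_zero] at this
    exact hfg this.symm
  have hdeg : D.natDegree ≤ Fintype.card n := by
    refine (natDegree_det_X_add_C_le _ _).trans ?_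
    rw [Fintype.card_fin]
    exact M.rank_le_card_width
  have hdet := hT' D hD0 hdeg
  rw [hev] at hdet
  have hrank := Matrix.rank_of_isUnit _ ((Matrix.isUnit_iff_isUnit_det _).2 hdet.isUnit)
  rw [Fintype.card_fin] at hrank
  rw [← hrank]
  exact Matrix.rank_submatrix_le _ _ _

section

variable {p : ℕ} [Fact p.Prime] {F : Type} [Field F] [Algebra (ZMod p) F] {ι : Type} [Fintype ι]

/-- The linear combination of the entries of `v` with the coefficients `x j + y j * T`, where
`q = (x, y)`. -/
def pencilSum (T : F) (v : ι → F) (q : (ι → ZMod p) × (ι → ZMod p)) : F :=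
  ∑ j, linForm T (q.1 j) (q.2 j) * v j

theorem pencilSum_add (T : F) (v : ι → F) (q q' : (ι → ZMod p) × (ι → ZMod p)) :
    pencilSum T v (q + q') = pencilSum T v q + pencilSum T v q' := by
  unfold pencilSum
  rw [← Finset.sum_add_distrib]
  refine Finset.sum_congr rfl fun j _ => ?_
  simp only [linForm, Prod.fst_add, Prod.snd_add, Pi.add_apply, map_add]
  ring

theorem pencilSum_neg (T : F) (v : ι → F) (q : (ι → ZMod p) × (ι → ZMod p)) :
    pencilSum T v (-q) = -pencilSum T v q := by
  unfold pencilSum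
  rw [← Finset.sum_neg_distrib]
  refine Finset.sum_congr rfl fun j _ => ?_
  simp only [linForm, Prod.fst_neg, Prod.snd_neg, Pi.neg_apply, map_neg]
  ring

theorem pencilSum_zero (T : F) (v : ι → F) :
    pencilSum T v (0 : (ι → ZMod p) × (ι → ZMod p)) = 0 := by
  simp [pencilSum, linForm]

theorem pencilSum_single [DecidableEq ι] (T : F) (v : ι → F) (i : ι) :
    pencilSum T v ((Pi.single i 1 : ι → ZMod p), 0) = v i := by
  unfold pencilSum
  rw [Finset.sum_eq_single i]
  · simp [linForm]
  · intro j _ hj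
    simp [linForm, hj]
  · simp

theorem linForm_mul_pencilSum (T : F) (v : ι → F) (r s : ZMod p) (x : ι → ZMod p) :
    linForm T r s * pencilSum T v (x, 0) = pencilSum T v (r • x, s • x) := by
  unfold pencilSum
  rw [Finset.mul_sum]
  refine Finset.sum_congr rfl fun j _ => ?_
  simp only [linForm, Pi.zero_apply, Pi.smul_apply, smul_eq_mul, map_mul, map_zero]
  ring

open Polynomial in
/-- If `T` and `T'` satisfy no polynomial relation of low degree, then there is a bijection
between tuples that preserves the linear relations with coefficients in the spans of `1` and `T`
and of `1` and `T'`. -/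
theorem exists_equiv_pencilSum_eq_zero [Finite F] {T T' : F}
    (hT : ∀ P : (ZMod p)[X], P ≠ 0 → P.natDegree ≤ Fintype.card ι → aeval T P ≠ 0)
    (hT' : ∀ P : (ZMod p)[X], P ≠ 0 → P.natDegree ≤ Fintype.card ι → aeval T' P ≠ 0) :
    ∃ e : (ι → F) ≃ (ι → F), ∀ v (q : (ι → ZMod p) × (ι → ZMod p)),
      pencilSum T v q = 0 ↔ pencilSum T' (e v) q = 0 := by
  obtain ⟨e, he⟩ := exists_equiv_of_card_fiber_eq
    (fun v : ι → F => {q : (ι → ZMod p) × (ι → ZMod p) | pencilSum T v q = 0})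
    (fun v : ι → F => {q : (ι → ZMod p) × (ι → ZMod p) | pencilSum T' v q = 0})
    (card_fiber_eq_of_card_subset_eq _ _ fun R => by
      -- It suffices to count the v satisfying all relations in R. They form the kernel of the
      -- pencil A + S B with rows indexed by R, so only its rank matters.
      have := Fintype.ofFinite R
      let A : Matrix R ι (ZMod p) := fun q j => q.1.1 j
      let B : Matrix R ι (ZMod p) := fun q j => q.1.2 j
      let M : F → Matrix R ι F := fun S =>
        A.map (algebraMap (ZMod p) F) + S • B.map (algebraMap (ZMod p) F)
      have hrank : (M T).rank = (M T').rank :=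
        (rank_pencil_le A B T T' hT').antisymm (rank_pencil_le A B T' T hT)
      have hcard : ∀ S : F, Nat.card {v : ι → F //
          R ⊆ {q : (ι → ZMod p) × (ι → ZMod p) | pencilSum S v q = 0}} =
          Nat.card F ^ (Fintype.card ι - (M S).rank) := by
        intro S
        have hker : Module.finrank F (LinearMap.ker (M S).mulVecLin) =
            Fintype.card ι - (M S).rank := by
          have := LinearMap.finrank_range_add_finrank_ker (M S).mulVecLin
          rw [Module.finrank_fintype_fun_eq_card] at this
          rw [Matrix.rank]
          omega
        rw [← hker, ← Module.natCard_eq_pow_finrank]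
        refine Nat.card_congr (Equiv.subtypeEquivRight fun v => ?_)
        rw [LinearMap.mem_ker, funext_iff, Subtype.forall]
        refine forall₂_congr fun q hq => ?_
        have : (M S).mulVecLin v ⟨q, hq⟩ = pencilSum S v q := by
          simp only [Matrix.mulVecLin_apply, Matrix.mulVec, dotProduct, pencilSum, linForm]
          refine Finset.sum_congr rfl fun j _ => ?_
          change (_ + S * _) * _ = _
          rw [mul_comm S]
          rfl
        rw [this]
        rfl
      rw [hcard, hcard, hrank])
  exact ⟨e, fun v q => (Set.ext_iff.1 (he v) q).symm⟩

namespace PencilGroup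

/-- The pairs of elements whose coordinates are given by the same coefficients. -/
def linked (T T' : F) (v v' : ι → F) : Subgroup (PencilGroup p T × PencilGroup p T') where
  carrier := {x | (x.1.r = x.2.r ∧ x.1.s = x.2.s) ∧
    (∃ u : ι → ZMod p, x.1.b = pencilSum T v (u, 0) ∧ x.2.b = pencilSum T' v' (u, 0)) ∧
    ∃ q : (ι → ZMod p) × (ι → ZMod p), x.1.c = pencilSum T v q ∧ x.2.c = pencilSum T' v' q}
  one_mem' := ⟨⟨rfl, rfl⟩, ⟨0, (pencilSum_zero _ _).symm, (pencilSum_zero _ _).symm⟩,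
    ⟨0, (pencilSum_zero _ _).symm, (pencilSum_zero _ _).symm⟩⟩
  mul_mem' := by
    rintro ⟨x, x'⟩ ⟨y, y'⟩ ⟨⟨hr, hs⟩, ⟨u, hu, hu'⟩, ⟨q, hq, hq'⟩⟩
      ⟨⟨kr, ks⟩, ⟨w, hw, hw'⟩, ⟨t, ht, ht'⟩⟩
    dsimp only at *
    refine ⟨⟨?_, ?_⟩, ⟨u + w, ?_, ?_⟩, ⟨q + t + (x.r • w, x.s • w), ?_, ?_⟩⟩
    · simp [hr, kr]
    · simp [hs, ks]
    · simp [hu, hw, ← pencilSum_add]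
    · simp [hu', hw', ← pencilSum_add]
    · simp only [pencilSum_add, ← linForm_mul_pencilSum, ← hw, ← hq, ← ht]
      rfl
    · simp only [pencilSum_add, ← linForm_mul_pencilSum, ← hw', ← hq', ← ht', hr, hs]
      rfl
  inv_mem' := by
    rintro ⟨x, x'⟩ ⟨⟨hr, hs⟩, ⟨u, hu, hu'⟩, ⟨q, hq, hq'⟩⟩
    dsimp only at *
    refine ⟨⟨?_, ?_⟩, ⟨-u, ?_, ?_⟩, ⟨-q + (x.r • u, x.s • u), ?_, ?_⟩⟩
    · simp [hr]
    · simp [hs]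
    · simp [hu, ← pencilSum_neg]
    · simp [hu', ← pencilSum_neg]
    · simp only [pencilSum_add, pencilSum_neg, ← linForm_mul_pencilSum, ← hu, ← hq]
      rfl
    · simp only [pencilSum_add, pencilSum_neg, ← linForm_mul_pencilSum, ← hu', ← hq', hr, hs]
      rfl

/-- The values of a word at the two tuples are again linked. Each is trivial iff r and s vanish and
two pencil sums vanish, and these conditions agree on both sides. -/
theorem groupInitialColor_eq_of_linked {T T' : F} {v v' : ι → F}
    (hv : ∀ q : (ι → ZMod p) × (ι → ZMod p), pencilSum T v q = 0 ↔ pencilSum T' v' q = 0) {k : ℕ}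
    {g : Fin k → PencilGroup p T} {h : Fin k → PencilGroup p T'}
    (hl : ∀ i, (g i, h i) ∈ linked T T' v v') :
    groupInitialColor g = groupInitialColor h := by
  have hw : ∀ w, (FreeGroup.lift g w, FreeGroup.lift h w) ∈ linked T T' v v' := by
    intro w
    induction w using FreeGroup.induction_on with
    | C1 => exact one_mem _
    | of i => simpa using hl i
    | inv_of i h => simpa using inv_mem (hl i)
    | mul x y hx hy => simpa using mul_mem hx hy
  ext w
  obtain ⟨⟨hr, hs⟩, ⟨u, hu, hu'⟩, ⟨q, hq, hq'⟩⟩ := hw w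
  dsimp only at *
  simp only [groupInitialColor, MonoidHom.mem_ker, PencilGroup.ext_iff, one_r, one_s, one_b,
    one_c, hr, hs, hu, hu', hq, hq', hv]

-- The entries b and c of a k-tuple are 2k elements of F, whence the degree bound. The bijection of
-- tuples keeps r and s and transforms only these 2k elements.
open Polynomial in
theorem equalProfiles [Finite F] {T T' : F} {k : ℕ}
    (hT : ∀ P : (ZMod p)[X], P ≠ 0 → P.natDegree ≤ 2 * k → aeval T P ≠ 0)
    (hT' : ∀ P : (ZMod p)[X], P ≠ 0 → P.natDegree ≤ 2 * k → aeval T' P ≠ 0) :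
    EqualProfiles k (PencilGroup p T) (PencilGroup p T') := by
  have hk : Fintype.card (Fin k ⊕ Fin k) = 2 * k := by simp [two_mul]
  obtain ⟨e, he⟩ := exists_equiv_pencilSum_eq_zero (ι := Fin k ⊕ Fin k)
    (fun P h0 h => hT P h0 (hk ▸ h)) (fun P h0 h => hT' P h0 (hk ▸ h))
  let coord (S : F) : (Fin k → PencilGroup p S) ≃
      ((Fin k → ZMod p) × (Fin k → ZMod p)) × (Fin k ⊕ Fin k → F) :=
    { toFun g := ((fun i => (g i).r, fun i => (g i).s),
        Sum.elim (fun i => (g i).b) (fun i => (g i).c))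
      invFun x := fun i => ⟨x.1.1 i, x.1.2 i, x.2 (Sum.inl i), x.2 (Sum.inr i)⟩
      left_inv g := rfl
      right_inv x := Prod.ext rfl (by
        funext i
        cases i <;> rfl) }
  let f := (coord T).trans ((Equiv.prodCongr (Equiv.refl _) e).trans (coord T').symm)
  refine EqualProfiles.of_equiv f fun g => ?_
  classical
  refine groupInitialColor_eq_of_linked (he (coord T g).2) fun i => ?_
  refine ⟨⟨rfl, rfl⟩, ⟨Pi.single (Sum.inl i) 1, ?_, ?_⟩,
    ⟨(Pi.single (Sum.inr i) 1, 0), ?_, ?_⟩⟩ <;> rw [pencilSum_single] <;> rfl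

end PencilGroup

end

/-! ## Recognition of the groups -/

open scoped commutatorElement

/-- The center of a group is commutative. -/
instance centerCommGroup {H : Type} [Group H] : CommGroup (Subgroup.center H) :=
  { (inferInstance : Group (Subgroup.center H)) with
    mul_comm := fun x y => Subtype.ext (Subgroup.mem_center_iff.1 y.2 x) }

/-- In a group of class at most two, taking the commutator with a fixed element is a homomorphism
to the center. -/
def commutatorHom {H : Type} [Group H] (hcl : ∀ x y : H, ⁅x, y⁆ ∈ Subgroup.center H) (a : H) :
    H →* Subgroup.center H where
  toFun x := ⟨⁅a, x⁆, hcl a x⟩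
  map_one' := Subtype.ext (commutatorElement_one_right a)
  map_mul' x y := Subtype.ext (by
    have h := (Subgroup.mem_center_iff.1 (hcl a y) x).symm
    change ⁅a, x * y⁆ = ⁅a, x⁆ * ⁅a, y⁆
    calc ⁅a, x * y⁆ = ⁅a, x⁆ * (x * ⁅a, y⁆ * x⁻¹) := by
          simp only [commutatorElement_def]
          group
      _ = ⁅a, x⁆ * ⁅a, y⁆ := by rw [← h, mul_inv_cancel_right])

theorem commutatorHom_apply {H : Type} [Group H] (hcl : ∀ x y : H, ⁅x, y⁆ ∈ Subgroup.center H)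
    (a x : H) : (commutatorHom hcl a x : H) = ⁅a, x⁆ := rfl

/-- A surjective linear map whose kernel is killed by a second one. -/
theorem exists_section_of_ker_le {K M Y : Type*} [Field K] [AddCommGroup M] [AddCommGroup Y]
    [Module K M] [Module K Y] (D₁ D₂ : M →ₗ[K] Y) (hsurj : Function.Surjective D₁)
    (hker : ∀ x, D₁ x = 0 → D₂ x = 0) :
    ∃ (S : Y →ₗ[K] M) (E : Module.End K Y), (∀ y, D₁ (S y) = y) ∧ ∀ x, E (D₁ x) = D₂ x := by
  obtain ⟨S, hS⟩ := D₁.exists_rightInverse_of_surjective (LinearMap.range_eq_top.2 hsurj)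
  have hS' : ∀ y, D₁ (S y) = y := fun y => LinearMap.congr_fun hS y
  refine ⟨S, D₂.comp S, hS', fun x => ?_⟩
  have := hker (S (D₁ x) - x) (by rw [map_sub, hS', sub_self])
  rw [map_sub, sub_eq_zero] at this
  exact this

section

variable {p : ℕ} [hp : Fact p.Prime] {F : Type} [Field F] [Algebra (ZMod p) F]

theorem pow_val_add {H : Type} [Group H] {x : H} (hx : x ^ p = 1) (r r' : ZMod p) :
    x ^ (r + r').val = x ^ r.val * x ^ r'.val := by
  rw [ZMod.val_add, ← pow_add, ← pow_eq_pow_mod _ hx]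

/-- An injective homomorphism to a group is a bijection onto it if the orders agree; here the
homomorphism is assembled from maps to the images of the coordinates. -/
theorem PencilGroup.nonempty_mulEquiv_of_coordinates [Finite F] {T : F} {H : Type} [Group H]
    [Finite H] (hcard : Nat.card H = Nat.card (PencilGroup p T)) (hpow : ∀ x : H, x ^ p = 1)
    (hcl : ∀ x y : H, ⁅x, y⁆ ∈ Subgroup.center H) {a₁ a₂ v : H} (h12 : Commute a₁ a₂)
    (hind : ∀ i j : ℕ, Commute v (a₁ ^ i * a₂ ^ j) → p ∣ i ∧ p ∣ j) (z σ : F → H)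
    (hzc : ∀ b x, Commute (z b) x) (hzadd : ∀ b b', z (b + b') = z b * z b')
    (hσadd : ∀ b b', σ (b + b') = σ b * σ b') (hz0 : ∀ b, z b = 1 → b = 0)
    (hσv : ∀ b, Commute v (σ b)) (hσ1 : ∀ b, ⁅a₁, σ b⁆ = z b)
    (hσ2 : ∀ b, ⁅a₂, σ b⁆ = z (T * b)) :
    Nonempty (PencilGroup p T ≃* H) := by
  have hznat : ∀ (n : ℕ) b, z (n * b) = z b ^ n := fun n b => by
    induction n with
    | zero => simpa using hzadd 0 0
    | succ n ih => rw [Nat.cast_succ, add_mul, one_mul, hzadd, ih, pow_succ]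
  let α (r s : ZMod p) : H := a₁ ^ r.val * a₂ ^ s.val
  have hαadd : ∀ r s r' s', α (r + r') (s + s') = α r s * α r' s' := fun r s r' s' => by
    simp only [α, pow_val_add (hpow _)]
    exact Commute.mul_mul_mul_comm (h12.pow_pow _ _) _ _
  have hασ : ∀ r s b, α r s * σ b = z (linForm T r s * b) * σ b * α r s := by
    intro r s b
    have h : ⁅α r s, σ b⁆ = z (linForm T r s * b) := by
      have e : linForm T r s * b = (r.val : F) * b + (s.val : F) * (T * b) := by
        rw [← map_natCast (algebraMap (ZMod p) F) r.val, ← map_natCast (algebraMap (ZMod p) F) s.val,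
          ZMod.natCast_zmod_val, ZMod.natCast_zmod_val, linForm]
        ring
      -- Inverting a commutator swaps its entries. This moves the powers of a₁ and a₂ into the
      -- second argument, where `commutatorHom` is multiplicative.
      rw [e, hzadd, hznat, hznat, ← hσ1, ← hσ2, ← commutatorElement_inv, ← commutatorElement_inv _ a₁,
        ← commutatorElement_inv _ a₂, ← commutatorHom_apply hcl, ← commutatorHom_apply hcl,
        ← commutatorHom_apply hcl]
      norm_cast
      rw [map_mul, map_pow, map_pow, mul_inv, inv_pow, inv_pow]
    rw [← h, commutatorElement_def]
    group
  let Φ : PencilGroup p T →* H := MonoidHom.mk' (fun x => σ x.b * z x.c * α x.r x.s) (by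
    intro x y
    simp only [mul_b, mul_c, mul_r, mul_s, hσadd, hzadd, hαadd]
    have h1 := (hzc x.c (σ y.b)).eq
    have h2 := (hzc y.c (α x.r x.s)).eq
    calc σ x.b * σ y.b * (z x.c * z y.c * z (x.a * y.b)) * (α x.r x.s * α y.r y.s)
        = σ x.b * (σ y.b * z x.c) * (z y.c * z (x.a * y.b)) * α x.r x.s * α y.r y.s := by group
      _ = σ x.b * z x.c * (σ y.b * (z (x.a * y.b) * z y.c)) * α x.r x.s * α y.r y.s := by
        rw [← h1, (hzc y.c (z (x.a * y.b))).eq]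
        group
      _ = σ x.b * z x.c * (z (x.a * y.b) * σ y.b) * (z y.c * α x.r x.s) * α y.r y.s := by
        rw [(hzc (x.a * y.b) (σ y.b)).eq]
        group
      _ = σ x.b * z x.c * (z (x.a * y.b) * σ y.b * α x.r x.s) * z y.c * α y.r y.s := by
        rw [h2]
        group
      _ = σ x.b * z x.c * (α x.r x.s * σ y.b) * z y.c * α y.r y.s := by
        rw [hασ]
        rfl
      _ = σ x.b * z x.c * α x.r x.s * (σ y.b * z y.c * α y.r y.s) := by group)
  have hΦ : Function.Injective Φ := by
    rw [injective_iff_map_eq_one]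
    intro x hx
    change σ x.b * z x.c * α x.r x.s = 1 at hx
    -- For x in the kernel, the α-part commutes with v, so r = s = 0. Then σ b is central, so its
    -- commutator z b with a₁ is trivial and b = 0; finally z c = 1.
    have hα : α x.r x.s = (σ x.b * z x.c)⁻¹ := eq_inv_of_mul_eq_one_right hx
    obtain ⟨hr, hs⟩ := hind x.r.val x.s.val (by
      change Commute v (α x.r x.s)
      rw [hα]
      exact ((hσv _).mul_right (hzc _ _).symm).inv_right)
    have hr' := Nat.eq_zero_of_dvd_of_lt hr (ZMod.val_lt _)
    have hs' := Nat.eq_zero_of_dvd_of_lt hs (ZMod.val_lt _)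
    have hα1 : α x.r x.s = 1 := by simp [α, hr', hs']
    rw [hα1, mul_one] at hx
    have hb : x.b = 0 := hz0 _ (by
      rw [← hσ1, eq_inv_of_mul_eq_one_left hx, commutatorElement_eq_one_iff_commute]
      exact (hzc _ _).symm.inv_right)
    have hc : x.c = 0 := hz0 _ (by
      have h0 : σ 0 = 1 := by simpa using hσadd 0 0
      rwa [hb, h0, one_mul] at hx)
    exact PencilGroup.ext ((ZMod.val_eq_zero _).1 hr') ((ZMod.val_eq_zero _).1 hs') hb hc
  exact ⟨MulEquiv.ofBijective Φ ((Nat.bijective_iff_injective_and_card Φ).2 ⟨hΦ, hcard.symm⟩)⟩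

/-- A pair of linear maps `D₁` and `D₂` for which `D₂ ∘ D₁⁻¹` satisfies the equation of a generator
of `F` contains a copy of the pair given by the identity and the multiplication by the generator. -/
theorem exists_linearMap_of_aeval_minpoly (pb : PowerBasis (ZMod p) F) {M Y : Type}
    [AddCommGroup M] [AddCommGroup Y] [Module (ZMod p) M] [Module (ZMod p) Y]
    (D₁ D₂ : M →ₗ[ZMod p] Y) (hsurj : Function.Surjective D₁) (hker : ∀ x, D₁ x = 0 → D₂ x = 0)
    (hmin : ∀ E : Module.End (ZMod p) Y, (∀ x, E (D₁ x) = D₂ x) →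
      Polynomial.aeval E (minpoly (ZMod p) pb.gen) = 0) {y₀ : Y} (hy₀ : y₀ ≠ 0) :
    ∃ (z : F →+ Y) (σ : F →+ M), (∀ b, z b = 0 → b = 0) ∧ (∀ b, D₁ (σ b) = z b) ∧
      ∀ b, D₂ (σ b) = z (pb.gen * b) := by
  obtain ⟨S, E, hS, hE⟩ := exists_section_of_ker_le D₁ D₂ hsurj hker
  -- The operator E = D₂ ∘ D₁⁻¹ satisfies the minimal polynomial of the generator, so it makes Y an
  -- F-space. The orbit map b ↦ b y₀ is injective since nonzero scalars are invertible.
  let L := pb.lift E (hmin E hE)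
  let z : F →+ Y := AddMonoidHom.mk' (fun b => L b y₀) fun b b' => by
    rw [map_add, LinearMap.add_apply]
  refine ⟨z, S.toAddMonoidHom.comp z, fun b hb => ?_, fun b => hS _, fun b => ?_⟩
  · by_contra hb0
    refine hy₀ ?_
    have : L (b⁻¹ * b) y₀ = 0 := by
      rw [map_mul, Module.End.mul_apply]
      exact (congrArg _ hb).trans (map_zero _)
    rwa [inv_mul_cancel₀ hb0, map_one, Module.End.one_apply] at this
  · change D₂ (S (L b y₀)) = L (pb.gen * b) y₀
    rw [← hE, hS, map_mul, Module.End.mul_apply, pb.lift_gen]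

/-- A finite group of the right order with elements that behave like the three generators of a
pencil group modulo its center is isomorphic to the pencil group. -/
theorem PencilGroup.nonempty_mulEquiv [Finite F] (pb : PowerBasis (ZMod p) F) {H : Type} [Group H]
    [Finite H] (hcard : Nat.card H = Nat.card (PencilGroup p pb.gen)) (hpow : ∀ x : H, x ^ p = 1)
    (hcl : ∀ x y : H, ⁅x, y⁆ ∈ Subgroup.center H) {a₁ a₂ v : H} (h12 : Commute a₁ a₂)
    (hab : ∀ x y, Commute v x → Commute v y → Commute x y)
    (hlift : ∀ z ∈ Subgroup.center H, ∃ x, Commute v x ∧ ⁅a₁, x⁆ = z)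
    (hker : ∀ x, Commute v x → ⁅a₁, x⁆ = 1 → ⁅a₂, x⁆ = 1)
    (hind : ∀ i j : ℕ, Commute v (a₁ ^ i * a₂ ^ j) → p ∣ i ∧ p ∣ j) (hv : ⁅a₁, v⁆ ≠ 1)
    (hmin : ∀ [Module (ZMod p) (Additive (Subgroup.center H))]
      (E : Module.End (ZMod p) (Additive (Subgroup.center H))),
      (∀ x, Commute v x → E (Additive.ofMul (commutatorHom hcl a₁ x)) =
        Additive.ofMul (commutatorHom hcl a₂ x)) →
      Polynomial.aeval E (minpoly (ZMod p) pb.gen) = 0) :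
    Nonempty (PencilGroup p pb.gen ≃* H) := by
  -- The centralizer of v plays the role of the matrices with a = 0. It is abelian of exponent
  -- dividing p, hence a vector space, on which commutators with a₁ and a₂ are linear maps to the
  -- center, modelled on multiplication by 1 and by T.
  set N := Subgroup.centralizer {v} with hN
  have memN : ∀ x, x ∈ N ↔ Commute v x := fun x => by
    rw [hN, Subgroup.mem_centralizer_singleton_iff]
    exact ⟨fun h => h.symm, fun h => h.symm⟩
  let _ : CommGroup N := { (inferInstance : Group N) with
    mul_comm := fun x y => Subtype.ext (hab x y ((memN _).1 x.2) ((memN _).1 y.2)) }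
  let _ : Module (ZMod p) (Additive N) := AddCommGroup.zmodModule fun x => by
    apply Additive.toMul.injective
    exact Subtype.ext (hpow (x.toMul : H))
  let _ : Module (ZMod p) (Additive (Subgroup.center H)) := AddCommGroup.zmodModule fun x => by
    apply Additive.toMul.injective
    exact Subtype.ext (hpow (x.toMul : H))
  let val (y : Additive (Subgroup.center H)) : H := (y.toMul : Subgroup.center H)
  let D (a : H) : Additive N →ₗ[ZMod p] Additive (Subgroup.center H) :=
    AddMonoidHom.toZModLinearMap p (MonoidHom.toAdditive ((commutatorHom hcl a).comp N.subtype))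
  obtain ⟨z, σ, hz0, hσ1, hσ2⟩ := exists_linearMap_of_aeval_minpoly pb (D a₁) (D a₂)
    (fun z => by
      obtain ⟨x, hx, e⟩ := hlift z.toMul z.toMul.2
      exact ⟨Additive.ofMul ⟨x, (memN x).2 hx⟩, congrArg Additive.ofMul (Subtype.ext e)⟩)
    (fun x hx => by
      have h1 : ⁅a₁, (x.toMul : H)⁆ = 1 := congrArg val hx
      exact congrArg Additive.ofMul (Subtype.ext (hker _ ((memN _).1 x.toMul.2) h1)))
    (fun E hE => hmin E fun x hx => hE (Additive.ofMul ⟨x, (memN x).2 hx⟩))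
    (y₀ := Additive.ofMul (commutatorHom hcl a₁ v)) (fun h => hv (congrArg val h))
  exact nonempty_mulEquiv_of_coordinates hcard hpow hcl h12 hind (fun b => val (z b))
    (fun b => ((σ b).toMul : N)) (fun b x => (Subgroup.mem_center_iff.1 (z b).toMul.2 x).symm)
    (fun b b' => congrArg val (map_add z b b'))
    (fun b b' => congrArg (fun y : Additive N => ((y.toMul : N) : H)) (map_add σ b b'))
    (fun b hb => hz0 b (congrArg Additive.ofMul (Subtype.ext hb : (z b).toMul = 1)))
    (fun b => (memN _).1 (σ b).toMul.2) (fun b => congrArg val (hσ1 b))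
    (fun b => congrArg val (hσ2 b))

end

/-! ## The Weisfeiler-Leman dimension -/

namespace GroupWLSim

section

variable {G H : Type} [Group G] [Group H] [Fintype G] [Fintype H] {k : ℕ}
  {g : Fin k → G} {h : Fin k → H}

theorem commutator_eq_one_iff (s : GroupWLSim g h) (i j : Fin k) :
    ⁅g i, g j⁆ = 1 ↔ ⁅h i, h j⁆ = 1 := by
  simpa using s.lift_eq_one_iff ⁅FreeGroup.of i, FreeGroup.of j⁆

theorem commute_iff (s : GroupWLSim g h) (i j : Fin k) :
    Commute (g i) (g j) ↔ Commute (h i) (h j) := by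
  simpa only [commutatorElement_eq_one_iff_commute] using s.commutator_eq_one_iff i j

theorem commutator_commute_iff (s : GroupWLSim g h) (i j l : Fin k) :
    Commute ⁅g i, g j⁆ (g l) ↔ Commute ⁅h i, h j⁆ (h l) := by
  simpa [commutatorElement_eq_one_iff_commute] using
    s.lift_eq_one_iff ⁅⁅FreeGroup.of i, FreeGroup.of j⁆, FreeGroup.of l⁆

theorem commutator_eq_iff (s : GroupWLSim g h) (i j l : Fin k) :
    ⁅g i, g j⁆ = g l ↔ ⁅h i, h j⁆ = h l := by
  simpa [mul_inv_eq_one] using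
    s.lift_eq_one_iff (⁅FreeGroup.of i, FreeGroup.of j⁆ * (FreeGroup.of l)⁻¹)

theorem eq_one_iff (s : GroupWLSim g h) (i : Fin k) : g i = 1 ↔ h i = 1 := by
  simpa using s.lift_eq_one_iff (FreeGroup.of i)

theorem pow_eq_one_iff (s : GroupWLSim g h) (i : Fin k) (n : ℕ) :
    g i ^ n = 1 ↔ h i ^ n = 1 := by
  simpa using s.lift_eq_one_iff (FreeGroup.of i ^ n)

theorem eq_mul_pow_iff (s : GroupWLSim g h) (i j l : Fin k) (n : ℕ) :
    g i = g j * g l ^ n ↔ h i = h j * h l ^ n := by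
  simpa only [map_mul, map_inv, map_pow, FreeGroup.lift_apply_of, mul_inv_eq_one] using
    s.lift_eq_one_iff (FreeGroup.of i * (FreeGroup.of j * FreeGroup.of l ^ n)⁻¹)

theorem commute_pow_mul_pow_iff (s : GroupWLSim g h) (i j l : Fin k) (m n : ℕ) :
    Commute (g l) (g i ^ m * g j ^ n) ↔ Commute (h l) (h i ^ m * h j ^ n) := by
  simpa [commutatorElement_eq_one_iff_commute] using
    s.lift_eq_one_iff ⁅FreeGroup.of l, FreeGroup.of i ^ m * FreeGroup.of j ^ n⁆

end

section

variable {G H : Type} [Group G] [Group H] [Fintype G] [Fintype H]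
  {g₀ g₁ g₂ g₃ g₄ g₅ : G} {h₀ h₁ h₂ h₃ h₄ h₅ : H}

/-- Positions 0, 1, 2 permanently hold the generators e₁, e₂, u and their counterparts; positions 3,
4, 5 are working registers. This accounts for the dimension 6. -/
theorem forth (s : GroupWLSim ![g₀, g₁, g₂, g₃, g₄, g₅] ![h₀, h₁, h₂, h₃, h₄, h₅]) (x : G) :
    ∃ y : H, GroupWLSim ![g₀, g₁, g₂, x, g₄, g₅] ![h₀, h₁, h₂, y, h₄, h₅] ∧
      GroupWLSim ![g₀, g₁, g₂, g₃, x, g₅] ![h₀, h₁, h₂, h₃, y, h₅] ∧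
      GroupWLSim ![g₀, g₁, g₂, g₃, g₄, x] ![h₀, h₁, h₂, h₃, h₄, y] := by
  have e3 : ∀ {K : Type} (k₀ k₁ k₂ k₃ k₄ k₅ x : K), Function.update ![k₀, k₁, k₂, k₃, k₄, k₅] 3 x =
      ![k₀, k₁, k₂, x, k₄, k₅] := fun _ _ _ _ _ _ _ => by
    funext i
    fin_cases i <;> rfl
  have e4 : ∀ {K : Type} (k₀ k₁ k₂ k₃ k₄ k₅ x : K), Function.update ![k₀, k₁, k₂, k₃, k₄, k₅] 4 x =
      ![k₀, k₁, k₂, k₃, x, k₅] := fun _ _ _ _ _ _ _ => by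
    funext i
    fin_cases i <;> rfl
  have e5 : ∀ {K : Type} (k₀ k₁ k₂ k₃ k₄ k₅ x : K), Function.update ![k₀, k₁, k₂, k₃, k₄, k₅] 5 x =
      ![k₀, k₁, k₂, k₃, k₄, x] := fun _ _ _ _ _ _ _ => by
    funext i
    fin_cases i <;> rfl
  obtain ⟨y, hy⟩ := s.exists_update x
  have h3 := hy 3
  have h4 := hy 4
  have h5 := hy 5
  rw [e3, e3] at h3
  rw [e4, e4] at h4
  rw [e5, e5] at h5
  exact ⟨y, h3, h4, h5⟩

theorem back (s : GroupWLSim ![g₀, g₁, g₂, g₃, g₄, g₅] ![h₀, h₁, h₂, h₃, h₄, h₅]) (y : H) :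
    ∃ x : G, GroupWLSim ![g₀, g₁, g₂, x, g₄, g₅] ![h₀, h₁, h₂, y, h₄, h₅] ∧
      GroupWLSim ![g₀, g₁, g₂, g₃, x, g₅] ![h₀, h₁, h₂, h₃, y, h₅] ∧
      GroupWLSim ![g₀, g₁, g₂, g₃, g₄, x] ![h₀, h₁, h₂, h₃, h₄, y] := by
  obtain ⟨x, h3, h4, h5⟩ := s.symm.forth y
  exact ⟨x, h3.symm, h4.symm, h5.symm⟩

/-- The centers correspond to each other. -/
theorem mem_center (s : GroupWLSim ![g₀, g₁, g₂, g₃, g₄, g₅] ![h₀, h₁, h₂, h₃, h₄, h₅])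
    (hc : h₃ ∈ Subgroup.center H) : g₃ ∈ Subgroup.center G := by
  refine Subgroup.mem_center_iff.2 fun x => ?_
  obtain ⟨y, -, s', -⟩ := s.forth x
  exact ((s'.commute_iff 4 3).2 (Subgroup.mem_center_iff.1 hc y)).eq

/-- Having class at most two is a law in three variables, so the three registers suffice to pull a
triple of H back to G. -/
theorem commutator_mem_center (s : GroupWLSim ![g₀, g₁, g₂, g₃, g₄, g₅] ![h₀, h₁, h₂, h₃, h₄, h₅])
    (hG : ∀ x y : G, ⁅x, y⁆ ∈ Subgroup.center G) (x y : H) : ⁅x, y⁆ ∈ Subgroup.center H := by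
  refine Subgroup.mem_center_iff.2 fun w => ?_
  obtain ⟨x', s, -⟩ := s.back x
  obtain ⟨y', -, s, -⟩ := s.back y
  obtain ⟨w', -, -, s⟩ := s.back w
  exact ((s.commutator_commute_iff 3 4 5).1 (Subgroup.mem_center_iff.1 (hG x' y') w').symm).eq.symm

theorem pow_eq_one (s : GroupWLSim ![g₀, g₁, g₂, g₃, g₄, g₅] ![h₀, h₁, h₂, h₃, h₄, h₅])
    {n : ℕ} (hG : ∀ x : G, x ^ n = 1) (x : H) : x ^ n = 1 := by
  obtain ⟨x', s, -⟩ := s.back x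
  exact (s.pow_eq_one_iff 3 n).1 (hG x')

end

end GroupWLSim

namespace PencilGroup

variable {p : ℕ} {F : Type} [Field F] [Algebra (ZMod p) F] {T : F}

theorem commutatorElement_eq (x y : PencilGroup p T) : ⁅x, y⁆ = ⟨0, 0, 0, x.a * y.b - y.a * x.b⟩ :=
  commutator_eq x y

@[simp] theorem a_mk (r s : ZMod p) (b c : F) : (⟨r, s, b, c⟩ : PencilGroup p T).a =
    linForm T r s := rfl

@[simp] theorem linForm_zero_zero : linForm T (0 : ZMod p) 0 = 0 := by simp [linForm]

@[simp] theorem linForm_one_zero : linForm T (1 : ZMod p) 0 = 1 := by simp [linForm]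

@[simp] theorem linForm_zero_one : linForm T (0 : ZMod p) 1 = T := by simp [linForm]

theorem commutator_mem_center (x y : PencilGroup p T) :
    ⁅x, y⁆ ∈ Subgroup.center (PencilGroup p T) := by
  refine Subgroup.mem_center_iff.2 fun z => ?_
  refine (commute_iff.2 ?_ : Commute z _).eq
  simp [commutatorElement_eq]

/-- The element with first matrix entry `1`. -/
abbrev e₁ (p : ℕ) (T : F) : PencilGroup p T := ⟨1, 0, 0, 0⟩

/-- The element with first matrix entry `T`. -/
abbrev e₂ (p : ℕ) (T : F) : PencilGroup p T := ⟨0, 1, 0, 0⟩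

/-- The element with second matrix entry `1`. -/
abbrev u (p : ℕ) (T : F) : PencilGroup p T := ⟨0, 0, 1, 0⟩

theorem commute_u_iff {x : PencilGroup p T} : Commute (u p T) x ↔ x.a = 0 := by
  rw [commute_iff]
  simp [eq_comm]

variable [hp : Fact p.Prime]

theorem mem_center_iff {x : PencilGroup p T} (hT : T ∉ Set.range (algebraMap (ZMod p) F)) :
    x ∈ Subgroup.center (PencilGroup p T) ↔ x = ⟨0, 0, 0, x.c⟩ := by
  constructor
  · intro h
    have h1 := commute_u_iff.1 (Subgroup.mem_center_iff.1 h (u p T))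
    have h2 := commute_iff.1 (show Commute _ _ from Subgroup.mem_center_iff.1 h (e₁ p T))
    obtain ⟨hr, hs⟩ := linForm_eq_zero hT h1
    exact PencilGroup.ext hr hs (by simpa using h2) rfl
  · intro h
    refine Subgroup.mem_center_iff.2 fun z => (commute_iff.2 ?_ : Commute z x).eq
    rw [h]
    simp

variable [Fintype F] {H : Type} [Group H] [Fintype H] {a₁ a₂ v h₃ h₄ h₅ : H}
  {g₃ g₄ g₅ : PencilGroup p T}

theorem commute_of_sim
    (s : GroupWLSim ![e₁ p T, e₂ p T, u p T, g₃, g₄, g₅] ![a₁, a₂, v, h₃, h₄, h₅]) (x y : H)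
    (hx : Commute v x) (hy : Commute v y) : Commute x y := by
  obtain ⟨x', s, -⟩ := s.back x
  obtain ⟨y', -, s, -⟩ := s.back y
  refine (s.commute_iff 3 4).1 ?_
  have hx' : x'.a = 0 := commute_u_iff.1 ((s.commute_iff 2 3).2 hx : Commute (u p T) x')
  have hy' : y'.a = 0 := commute_u_iff.1 ((s.commute_iff 2 4).2 hy : Commute (u p T) y')
  change Commute x' y'
  rw [commute_iff, hx', hy']
  simp

/-- In the pencil group the central element with entry c is the commutator of e₁ with the element
whose only nonzero entry is b = c. -/
theorem exists_commutator_eq_of_sim (hT : T ∉ Set.range (algebraMap (ZMod p) F))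
    (s : GroupWLSim ![e₁ p T, e₂ p T, u p T, g₃, g₄, g₅] ![a₁, a₂, v, h₃, h₄, h₅]) (z : H)
    (hz : z ∈ Subgroup.center H) : ∃ x, Commute v x ∧ ⁅a₁, x⁆ = z := by
  obtain ⟨z', s, -⟩ := s.back z
  have hz' := (mem_center_iff hT).1 (s.mem_center hz)
  obtain ⟨x, -, s, -⟩ := s.forth ⟨0, 0, z'.c, 0⟩
  refine ⟨x, (s.commute_iff 2 4).1 ?_, (s.commutator_eq_iff 0 4 3).1 ?_⟩
  · exact commute_u_iff.2 (by simp)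
  · change ⁅e₁ p T, (⟨0, 0, z'.c, 0⟩ : PencilGroup p T)⁆ = z'
    rw [hz', commutatorElement_eq]
    simp

theorem commutator_eq_one_of_sim
    (s : GroupWLSim ![e₁ p T, e₂ p T, u p T, g₃, g₄, g₅] ![a₁, a₂, v, h₃, h₄, h₅]) (x : H)
    (hx : Commute v x) (h : ⁅a₁, x⁆ = 1) : ⁅a₂, x⁆ = 1 := by
  obtain ⟨x', s, -⟩ := s.back x
  refine (s.commutator_eq_one_iff 1 3).1 ?_
  have hx' : x'.a = 0 := commute_u_iff.1 ((s.commute_iff 2 3).2 hx : Commute (u p T) x')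
  have h' : ⁅e₁ p T, x'⁆ = 1 := (s.commutator_eq_one_iff 0 3).2 h
  rw [commutatorElement_eq, hx'] at h'
  have hb : x'.b = 0 := by simpa using congrArg PencilGroup.c h'
  change ⁅e₂ p T, x'⁆ = 1
  rw [commutatorElement_eq, hx', hb]
  ext <;> simp

theorem dvd_of_sim (hT : T ∉ Set.range (algebraMap (ZMod p) F))
    (s : GroupWLSim ![e₁ p T, e₂ p T, u p T, g₃, g₄, g₅] ![a₁, a₂, v, h₃, h₄, h₅]) (i j : ℕ)
    (h : Commute v (a₁ ^ i * a₂ ^ j)) : p ∣ i ∧ p ∣ j := by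
  have h' : Commute (u p T) (e₁ p T ^ i * e₂ p T ^ j) :=
    (s.commute_pow_mul_pow_iff 0 1 2 i j).2 h
  obtain ⟨hr, hs⟩ := linForm_eq_zero hT (commute_u_iff.1 h')
  simp only [mul_r, mul_s, pow_eq] at hr hs
  exact ⟨(ZMod.natCast_eq_zero_iff i p).1 (by simpa using hr),
    (ZMod.natCast_eq_zero_iff j p).1 (by simpa using hs)⟩

open Polynomial in
/-- The action of polynomials on the centers, defined through the commutators with the first two
generators, is preserved. -/
theorem exists_sim_aeval (hcl : ∀ x y : H, ⁅x, y⁆ ∈ Subgroup.center H)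
    [Module (ZMod p) (Additive (Subgroup.center H))]
    {E : Module.End (ZMod p) (Additive (Subgroup.center H))}
    (hE : ∀ x, Commute v x → E (Additive.ofMul (commutatorHom hcl a₁ x)) =
        Additive.ofMul (commutatorHom hcl a₂ x)) {c : F} {z : Additive (Subgroup.center H)}
    (s : GroupWLSim ![e₁ p T, e₂ p T, u p T, ⟨0, 0, 0, c⟩, g₄, g₅]
      ![a₁, a₂, v, (z.toMul : Subgroup.center H), h₄, h₅]) (P : (ZMod p)[X]) :
    ∃ (x : PencilGroup p T) (y : H),
      GroupWLSim ![e₁ p T, e₂ p T, u p T, ⟨0, 0, 0, c⟩, ⟨0, 0, 0, aeval T P * c⟩, x]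
        ![a₁, a₂, v, (z.toMul : Subgroup.center H), ((aeval E P z).toMul : Subgroup.center H), y] := by
  -- Horner's scheme: position 3 keeps the argument, position 4 the current value, and position 5 is
  -- scratch space. A relation between the entries identifies each new partner in H.
  induction P using Polynomial.recOnHorner with
  | M0 =>
    obtain ⟨y, -, s, -⟩ := s.forth 1
    have hy : y = 1 := (s.eq_one_iff 4).1 rfl
    subst hy
    refine ⟨g₅, h₅, ?_⟩
    simp only [map_zero, zero_mul]
    exact s
  | MC P a _ _ ih =>
    obtain ⟨x, y, s⟩ := ih
    -- The sum depends on positions 3 and 4, so it is formed in position 5 and only afterwards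
    -- copied to position 4.
    obtain ⟨w, -, -, s⟩ := s.forth ⟨0, 0, 0, aeval T (P + C a) * c⟩
    have hw : w = ((aeval E (P + C a) z).toMul : Subgroup.center H) := by
      refine ((s.eq_mul_pow_iff 5 4 3 a.val).1 ?_).trans ?_
      · change (⟨0, 0, 0, aeval T (P + C a) * c⟩ : PencilGroup p T) =
          ⟨0, 0, 0, aeval T P * c⟩ * ⟨0, 0, 0, c⟩ ^ a.val
        rw [pow_eq]
        refine PencilGroup.ext (by simp) (by simp) (by simp) ?_
        simp only [mul_c, map_add, aeval_C]
        rw [← map_natCast (algebraMap (ZMod p) F), ZMod.natCast_zmod_val]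
        simp [add_mul]
      · change ((aeval E P z).toMul : H) * (z.toMul : H) ^ a.val = _
        rw [map_add, aeval_C, LinearMap.add_apply, Module.algebraMap_end_apply]
        conv_rhs => rw [← ZMod.natCast_zmod_val a, Nat.cast_smul_eq_nsmul]
        rfl
    subst hw
    obtain ⟨w', -, s', -⟩ := s.forth ⟨0, 0, 0, aeval T (P + C a) * c⟩
    have hw' : w' = ((aeval E (P + C a) z).toMul : Subgroup.center H) := by
      have := (s'.eq_mul_pow_iff 4 5 3 0).1 (by simp)
      simpa using this
    subst hw'
    exact ⟨_, _, s'⟩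
  | MX P _ ih =>
    obtain ⟨x, y, s⟩ := ih
    -- Multiplication by T: position 5 receives a preimage of the current value under the commutator
    -- with e₁. Its commutator with e₂ then replaces the value in position 4.
    obtain ⟨w, -, -, s⟩ := s.forth ⟨0, 0, aeval T P * c, 0⟩
    have hw : Commute v w := (s.commute_iff 2 5).1 (commute_u_iff.2 (by simp))
    have hw1 : ⁅a₁, w⁆ = ((aeval E P z).toMul : Subgroup.center H) := by
      refine (s.commutator_eq_iff 0 5 4).1 ?_
      change ⁅e₁ p T, (⟨0, 0, aeval T P * c, 0⟩ : PencilGroup p T)⁆ = ⟨0, 0, 0, aeval T P * c⟩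
      rw [commutatorElement_eq]
      simp
    obtain ⟨y', -, s', -⟩ := s.forth ⟨0, 0, 0, aeval T (P * X) * c⟩
    have hw2 : ⁅a₂, w⁆ = y' := by
      refine (s'.commutator_eq_iff 1 5 4).1 ?_
      change ⁅e₂ p T, (⟨0, 0, aeval T P * c, 0⟩ : PencilGroup p T)⁆ =
        ⟨0, 0, 0, aeval T (P * X) * c⟩
      rw [commutatorElement_eq]
      refine PencilGroup.ext rfl rfl rfl ?_
      simp only [a_mk, linForm_zero_one, linForm_zero_zero, map_mul, aeval_X]
      ring
    have hy' : y' = ((aeval E (P * X) z).toMul : Subgroup.center H) := by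
      have h1 : Additive.ofMul (commutatorHom hcl a₁ w) = aeval E P z :=
        congrArg Additive.ofMul (Subtype.ext hw1)
      have h2 := hE w hw
      rw [h1] at h2
      have h3 : aeval E (P * X) z = E (aeval E P z) := by
        rw [mul_comm, map_mul, aeval_X, Module.End.mul_apply]
      rw [h3, h2]
      exact hw2.symm
    subst hy'
    exact ⟨_, _, s'⟩

/-- Horner's scheme for the minimal polynomial ends with the identity on the side of the pencil
group, so it does on the other side, from any starting element of the center. -/
theorem aeval_minpoly_eq_zero_of_sim (hT : T ∉ Set.range (algebraMap (ZMod p) F))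
    (s : GroupWLSim ![e₁ p T, e₂ p T, u p T, g₃, g₄, g₅] ![a₁, a₂, v, h₃, h₄, h₅])
    (hcl : ∀ x y : H, ⁅x, y⁆ ∈ Subgroup.center H)
    [Module (ZMod p) (Additive (Subgroup.center H))]
    {E : Module.End (ZMod p) (Additive (Subgroup.center H))}
    (hE : ∀ x, Commute v x → E (Additive.ofMul (commutatorHom hcl a₁ x)) =
        Additive.ofMul (commutatorHom hcl a₂ x)) :
    Polynomial.aeval E (minpoly (ZMod p) T) = 0 := by
  refine LinearMap.ext fun z => ?_
  obtain ⟨z', s, -⟩ := s.back (z.toMul : Subgroup.center H)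
  rw [(mem_center_iff hT).1 (s.mem_center z.toMul.2)] at s
  obtain ⟨x, y, s⟩ := exists_sim_aeval hcl hE s (minpoly (ZMod p) T)
  rw [minpoly.aeval, zero_mul] at s
  exact congrArg Additive.ofMul (Subtype.ext ((s.eq_one_iff 4).1 rfl))

theorem groupWLDimLE (h2 : p ≠ 2) (pb : PowerBasis (ZMod p) F)
    (hT : pb.gen ∉ Set.range (algebraMap (ZMod p) F)) : GroupWLDimLE 6 (PencilGroup p pb.gen) := by
  intro H _ _ e
  have hcard := e.card_eq (by norm_num)
  rw [Fintype.card_eq_nat_card, Fintype.card_eq_nat_card] at hcard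
  obtain ⟨f, hf⟩ := e
  have s : GroupWLSim _ _ := hf ![e₁ p pb.gen, e₂ p pb.gen, u p pb.gen, 1, 1, 1]
  generalize f ![e₁ p pb.gen, e₂ p pb.gen, u p pb.gen, 1, 1, 1] = h at s
  have hh : h = ![h 0, h 1, h 2, h 3, h 4, h 5] := by
    funext i
    fin_cases i <;> rfl
  rw [hh] at s
  have hcl := s.commutator_mem_center commutator_mem_center
  refine nonempty_mulEquiv pb hcard.symm (s.pow_eq_one (pow_prime h2)) hcl
    ((s.commute_iff 0 1).1 ?_) (commute_of_sim s) (exists_commutator_eq_of_sim hT s)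
    (commutator_eq_one_of_sim s) (dvd_of_sim hT s) (fun h => ?_)
    (fun E hE => aeval_minpoly_eq_zero_of_sim hT s hcl hE)
  · exact commute_iff.2 (by simp)
  · have h' : ⁅e₁ p pb.gen, u p pb.gen⁆ = 1 := (s.commutator_eq_one_iff 0 2).2 h
    rw [commutatorElement_eq] at h'
    simpa using congrArg PencilGroup.c h'

end PencilGroup

/-! ## Non-isomorphic pairs -/

namespace PencilGroup

variable {p : ℕ} [hp : Fact p.Prime] {F : Type} [Field F] [Algebra (ZMod p) F] {T T' : F}

theorem card_commute_le [Finite F] {x : PencilGroup p T} (hx : x.a ≠ 0) :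
    Nat.card {y // Commute x y} ≤ p ^ 2 * Nat.card F := by
  have hinj : Function.Injective
      (fun y : {y // Commute x y} => (((y.1.r, y.1.s), y.1.c) : (ZMod p × ZMod p) × F)) := by
    rintro ⟨y, hy⟩ ⟨y', hy'⟩ h
    simp only [Prod.mk.injEq] at h
    obtain ⟨⟨hr, hs⟩, hc⟩ := h
    rw [commute_iff] at hy hy'
    have ha : y.a = y'.a := by simp only [a, hr, hs]
    refine Subtype.ext (PencilGroup.ext hr hs ?_ hc)
    exact mul_left_cancel₀ hx (by rw [hy, hy', ha])
  refine (Nat.card_le_card_of_injective _ hinj).trans ?_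
  simp [sq]

theorem le_card_commute [Finite F] {x : PencilGroup p T} (hx : x.a = 0) :
    Nat.card F * Nat.card F ≤ Nat.card {y // Commute x y} := by
  rw [← Nat.card_prod]
  refine Nat.card_le_card_of_injective
    (fun b : F × F => ⟨⟨0, 0, b.1, b.2⟩, commute_iff.2 (by simp [hx])⟩) fun b b' h => ?_
  have h' := congrArg Subtype.val h
  exact Prod.ext (congrArg PencilGroup.b h') (congrArg PencilGroup.c h')

/-- Centralizer orders recognize the elements with a = 0: there they are at least |F|², elsewhere at
most p² |F|. -/
theorem a_apply_eq_zero [Finite F] (hF : p ^ 2 < Nat.card F)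
    (θ : PencilGroup p T ≃* PencilGroup p T') {x : PencilGroup p T} (hx : x.a = 0) :
    (θ x).a = 0 := by
  by_contra h
  have h1 := card_commute_le h
  have h2 := le_card_commute hx
  have e : Nat.card {y // Commute x y} = Nat.card {y // Commute (θ x) y} :=
    Nat.card_congr (θ.toEquiv.subtypeEquiv fun y => (commute_map_iff θ.injective).symm)
  rw [e] at h2
  exact absurd (h2.trans h1) (not_le.2 (Nat.mul_lt_mul_of_pos_right hF Nat.card_pos))

open Polynomial in
/-- If two groups are isomorphic, then the parameter of the first is conjugate to the image of
that of the second under a linear fractional transformation. -/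
theorem exists_aeval_minpoly_eq_zero [Finite F] (hF : p ^ 2 < Nat.card F)
    (θ : PencilGroup p T ≃* PencilGroup p T') : ∃ r s r' s' : ZMod p, linForm T' r s ≠ 0 ∧
      aeval (linForm T' r' s' / linForm T' r s) (minpoly (ZMod p) T) = 0 := by
  let f (b : F) : F := (θ ⟨0, 0, b, 0⟩).b
  let g : F →+ F := AddMonoidHom.mk' (fun c => (θ ⟨0, 0, 0, c⟩).c) fun c c' => by
    have h : (⟨0, 0, 0, c + c'⟩ : PencilGroup p T) = ⟨0, 0, 0, c⟩ * ⟨0, 0, 0, c'⟩ := by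
      ext <;> simp
    have h0 : (θ ⟨0, 0, 0, c⟩).a = 0 := a_apply_eq_zero hF θ (by simp)
    rw [h, map_mul, mul_c, h0, zero_mul, add_zero]
  -- Commutators with elements having a = 0 express multiplication by x.a, so θ carries it to
  -- multiplication by the a-entry of θ x. No additivity of f is needed.
  have hcomm : ∀ (x : PencilGroup p T) (b : F),
      θ ⟨0, 0, 0, x.a * b⟩ = ⟨0, 0, 0, (θ x).a * f b⟩ := by
    intro x b
    have h : (⟨0, 0, 0, x.a * b⟩ : PencilGroup p T) = ⁅x, ⟨0, 0, b, 0⟩⁆ := by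
      rw [commutatorElement_eq]
      simp
    have h0 : (θ ⟨0, 0, b, 0⟩).a = 0 := a_apply_eq_zero hF θ (by simp)
    rw [h, map_commutatorElement, commutatorElement_eq, h0, zero_mul, sub_zero]
  have hg1 : ∀ b, g b = (θ (e₁ p T)).a * f b := fun b => by
    have := congrArg PencilGroup.c (hcomm (e₁ p T) b)
    rwa [a_mk, linForm_one_zero, one_mul] at this
  have hg2 : ∀ b, g (T * b) = (θ (e₂ p T)).a * f b := fun b => by
    have := congrArg PencilGroup.c (hcomm (e₂ p T) b)
    rwa [a_mk, linForm_zero_one] at this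
  have hg0 : g 1 ≠ 0 := by
    intro h
    have h1 : θ ⟨0, 0, 0, 1⟩ = 1 := by
      have := hcomm (e₁ p T) 1
      rw [← hg1, h, a_mk, linForm_one_zero, one_mul] at this
      exact this
    have h2 := (map_eq_one_iff θ θ.injective).1 h1
    exact one_ne_zero (congrArg PencilGroup.c h2)
  have ha : (θ (e₁ p T)).a ≠ 0 := fun h => hg0 (by rw [hg1, h, zero_mul])
  refine ⟨(θ (e₁ p T)).r, (θ (e₁ p T)).s, (θ (e₂ p T)).r, (θ (e₂ p T)).s, ha, ?_⟩
  change aeval ((θ (e₂ p T)).a / (θ (e₁ p T)).a) (minpoly (ZMod p) T) = 0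
  set S := (θ (e₂ p T)).a / (θ (e₁ p T)).a with hS
  -- The additive map g intertwines multiplication by T with multiplication by S, hence by P(T) with
  -- P(S). As g 1 ≠ 0, the minimal polynomial of T vanishes at S.
  have hgT : ∀ b, g (T * b) = S * g b := fun b => by
    rw [hg1 b, hg2, hS]
    field_simp
  have hP : ∀ P : (ZMod p)[X], g (aeval T P) = aeval S P * g 1 := by
    intro P
    induction P using Polynomial.recOnHorner with
    | M0 => simp
    | MC P a _ _ ih =>
      have hC : g (algebraMap (ZMod p) F a) = algebraMap (ZMod p) F a * g 1 := by
        have := ZMod.map_smul g a (1 : F)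
        simpa [Algebra.smul_def] using this
      rw [map_add, map_add, map_add, aeval_C, aeval_C, ih, hC, add_mul]
    | MX P _ ih =>
      rw [mul_comm P, map_mul (aeval T), map_mul (aeval S), aeval_X, aeval_X, hgT, ih]
      ring
  have h0 := hP (minpoly (ZMod p) T)
  rw [minpoly.aeval, map_zero] at h0
  exact (mul_eq_zero.1 h0.symm).resolve_right hg0

end PencilGroup

section

variable {p : ℕ} [hp : Fact p.Prime] {F : Type} [Field F] [Algebra (ZMod p) F]

-- A root in the prime field would force the irreducible minimal polynomial of T to have degree 1.
open Polynomial in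
theorem notMem_range_of_aeval_minpoly [Finite F] {T S : F}
    (hT : T ∉ Set.range (algebraMap (ZMod p) F)) (hS : aeval S (minpoly (ZMod p) T) = 0) :
    S ∉ Set.range (algebraMap (ZMod p) F) := by
  rintro ⟨a, rfl⟩
  rw [aeval_algebraMap_apply, map_eq_zero] at hS
  have hint : IsIntegral (ZMod p) T := Algebra.IsIntegral.isIntegral T
  have hdeg := degree_eq_one_of_irreducible_of_root (minpoly.irreducible hint)
    (by simpa [coe_aeval_eq_eval] using hS : IsRoot _ a)
  exact hT (minpoly.mem_range_of_degree_eq_one _ _ hdeg)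

open Polynomial in
/-- A sufficiently large field contains two elements outside the prime field that belong to
non-isomorphic groups. -/
theorem exists_isEmpty_mulEquiv [Finite F] {d : ℕ} (hd : Module.finrank (ZMod p) F = d)
    (hF : p ^ 4 * d + p < Nat.card F) (hF2 : p ^ 2 < Nat.card F) :
    ∃ T T' : F, T ∉ Set.range (algebraMap (ZMod p) F) ∧ T' ∉ Set.range (algebraMap (ZMod p) F) ∧
      IsEmpty (PencilGroup p T ≃* PencilGroup p T') := by
  classical
  have := Fintype.ofFinite F
  rw [Nat.card_eq_fintype_card] at hF
  have hrange : (Finset.univ.image (algebraMap (ZMod p) F)).card ≤ p :=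
    Finset.card_image_le.trans (by rw [Finset.card_univ, ZMod.card])
  obtain ⟨T, hT⟩ : ∃ T, T ∉ Finset.univ.image (algebraMap (ZMod p) F) := by
    by_contra! h
    rw [Finset.eq_univ_iff_forall.2 h, Finset.card_univ] at hrange
    omega
  have hT' : T ∉ Set.range (algebraMap (ZMod p) F) := by simpa using hT
  -- Solving S = (r' + s' T') / (r + s T') for T'. With S among the at most d conjugates of T this
  -- gives at most p^4 d values to avoid; zero denominators only add harmless values.
  let φ : (ZMod p × ZMod p) × (ZMod p × ZMod p) → F → F := fun x S =>
    (S * algebraMap (ZMod p) F x.1.1 - algebraMap (ZMod p) F x.2.1) /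
      (algebraMap (ZMod p) F x.2.2 - S * algebraMap (ZMod p) F x.1.2)
  let R := ((minpoly (ZMod p) T).aroots F).toFinset
  have hint : IsIntegral (ZMod p) T := Algebra.IsIntegral.isIntegral T
  have hR : R.card ≤ d := by
    refine (Multiset.toFinset_card_le _).trans ((card_roots' _).trans ?_)
    rw [(minpoly.monic hint).natDegree_map, ← hd]
    exact minpoly.natDegree_le T
  let B := (Finset.univ ×ˢ R).image fun x => φ x.1 x.2
  have hB : B.card ≤ p ^ 4 * d := by
    refine Finset.card_image_le.trans ?_
    rw [Finset.card_product, Finset.card_univ, Fintype.card_prod, Fintype.card_prod, ZMod.card]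
    exact Nat.mul_le_mul (by ring_nf; rfl) hR
  obtain ⟨T', hTB⟩ : ∃ T', T' ∉ B ∪ Finset.univ.image (algebraMap (ZMod p) F) := by
    by_contra! h
    have h1 := Finset.card_union_le B (Finset.univ.image (algebraMap (ZMod p) F))
    rw [Finset.eq_univ_iff_forall.2 h, Finset.card_univ] at h1
    omega
  rw [Finset.mem_union, not_or] at hTB
  refine ⟨T, T', hT', by simpa using hTB.2, ⟨fun θ => hTB.1 ?_⟩⟩
  obtain ⟨r, s, r', s', hne, h0⟩ := PencilGroup.exists_aeval_minpoly_eq_zero hF2 θ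
  set S := linForm T' r' s' / linForm T' r s with hS
  have hSmul : linForm T' r' s' = S * linForm T' r s := by
    rw [hS, div_mul_cancel₀ _ hne]
  have hSr := notMem_range_of_aeval_minpoly hT' h0
  refine Finset.mem_image.2 ⟨(((r, s), (r', s')), S), Finset.mem_product.2
    ⟨Finset.mem_univ _, ?_⟩, ?_⟩
  · exact Multiset.mem_toFinset.2 (mem_aroots.2 ⟨minpoly.ne_zero hint, h0⟩)
  · have hden : algebraMap (ZMod p) F s' - S * algebraMap (ZMod p) F s ≠ 0 := by
      intro hz
      unfold linForm at hSmul hne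
      have h1 : algebraMap (ZMod p) F r' = S * algebraMap (ZMod p) F r := by
        linear_combination hSmul - T' * hz
      by_cases hs : s = 0
      · have hr : algebraMap (ZMod p) F r ≠ 0 := by simpa [hs] using hne
        exact hSr ⟨r' / r, by rw [map_div₀, h1, mul_div_cancel_right₀ _ hr]⟩
      · have hs' : algebraMap (ZMod p) F s ≠ 0 := by simpa using hs
        exact hSr ⟨s' / s, by rw [map_div₀, sub_eq_zero.1 hz, mul_div_cancel_right₀ _ hs']⟩
    change (_ - _) / (_ - _) = T'
    rw [div_eq_iff hden]
    unfold linForm at hSmul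
    linear_combination -hSmul

/-- In an extension of prime degree of the prime field, every element outside the prime field is
a generator. -/
theorem exists_powerBasis_gen_eq (hd : (Module.finrank (ZMod p) F).Prime) {T : F}
    (hT : T ∉ Set.range (algebraMap (ZMod p) F)) : ∃ pb : PowerBasis (ZMod p) F, pb.gen = T := by
  have := Subalgebra.isSimpleOrder_of_finrank_prime (ZMod p) F hd
  have : FiniteDimensional (ZMod p) F := Module.finite_of_finrank_pos hd.pos
  have htop : Algebra.adjoin (ZMod p) {T} = ⊤ := by
    refine (eq_bot_or_eq_top _).resolve_left fun h => hT ?_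
    have hmem := Algebra.self_mem_adjoin_singleton (ZMod p) T
    rwa [h, Algebra.mem_bot] at hmem
  exact ⟨PowerBasis.ofAdjoinEqTop (Algebra.IsIntegral.isIntegral T) htop,
    PowerBasis.ofAdjoinEqTop_gen _ _⟩

end

/-- This makes p^d large enough to avoid the excluded values. It fails for p = 3 and d = 5, whence
the bound d ≥ 7. -/
theorem add_one_le_pow_sub_four {p d : ℕ} (hp : 3 ≤ p) (hd : 7 ≤ d) : d + 1 ≤ p ^ (d - 4) := by
  refine le_trans ?_ (Nat.pow_le_pow_left hp _)
  induction d, hd using Nat.le_induction with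
  | base => norm_num
  | succ d hd ih =>
    rw [Nat.succ_sub (by omega), pow_succ]
    omega

/-- The properties of a suitable pair of groups. -/
theorem exists_pencilGroup_pair {p : ℕ} [hp : Fact p.Prime] (h2 : p ≠ 2) {d : ℕ} (hd : d.Prime)
    (h7 : 7 ≤ d) : ∃ (F : Type) (_ : Field F) (_ : Algebra (ZMod p) F) (_ : Fintype F) (T T' : F),
      Nat.card F = p ^ d ∧ IsEmpty (PencilGroup p T ≃* PencilGroup p T') ∧
      GroupWLDimLE 6 (PencilGroup p T) ∧ GroupWLDimLE 6 (PencilGroup p T') ∧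
      (∀ k, 2 * k < d → EqualProfiles k (PencilGroup p T) (PencilGroup p T')) ∧
      Nonempty (commutingGraph (PencilGroup p T) ≃g commutingGraph (PencilGroup p T')) := by
  have hp3 : 3 ≤ p := lt_of_le_of_ne hp.out.two_le h2.symm
  have hcard : Nat.card (GaloisField p d) = p ^ d := GaloisField.card p d hd.ne_zero
  have hfin : Module.finrank (ZMod p) (GaloisField p d) = d := GaloisField.finrank p hd.ne_zero
  have hpow : p ^ 4 * (d + 1) ≤ p ^ d := by
    calc p ^ 4 * (d + 1) ≤ p ^ 4 * p ^ (d - 4) :=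
          Nat.mul_le_mul_left _ (add_one_le_pow_sub_four hp3 h7)
      _ = p ^ d := by rw [← pow_add, Nat.add_sub_cancel' (by omega)]
  have hp4 : p < p ^ 4 := lt_self_pow₀ (by omega) (by norm_num)
  obtain ⟨T, T', hT, hT', hne⟩ := exists_isEmpty_mulEquiv hfin
    (by rw [hcard]; linarith)
    (by rw [hcard]; exact Nat.pow_lt_pow_right (by omega) (by omega))
  obtain ⟨pb, hpb⟩ := exists_powerBasis_gen_eq (by rwa [hfin]) hT
  obtain ⟨pb', hpb'⟩ := exists_powerBasis_gen_eq (by rwa [hfin]) hT'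
  -- A generator has degree d over the prime field, so it is no root of a nonzero polynomial of
  -- degree at most 2k < d.
  have hdim : ∀ pb : PowerBasis (ZMod p) (GaloisField p d), ∀ k, 2 * k < d →
      ∀ P : Polynomial (ZMod p), P ≠ 0 → P.natDegree ≤ 2 * k → Polynomial.aeval pb.gen P ≠ 0 := by
    intro pb k hk P hP hdeg h0
    have := pb.dim_le_natDegree_of_root hP h0
    rw [← pb.finrank, hfin] at this
    omega
  have := Fintype.ofFinite (GaloisField p d)
  refine ⟨GaloisField p d, inferInstance, inferInstance, this, T, T', hcard, hne, ?_, ?_,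
    fun k hk => ?_, PencilGroup.nonempty_commutingGraph_iso hT hT'⟩
  · subst hpb
    exact PencilGroup.groupWLDimLE h2 pb hT
  · subst hpb'
    exact PencilGroup.groupWLDimLE h2 pb' hT'
  · subst hpb hpb'
    exact PencilGroup.equalProfiles (hdim pb k hk) (hdim pb' k hk)

theorem mainTheorem1 :
    ∃ K : ℕ, 2 ≤ K ∧ ∀ p : ℕ, p.Prime → p ≠ 2 →
      ∃ c₁ c₂ c₃ : ℝ, 0 < c₁ ∧ 0 < c₂ ∧ 0 < c₃ ∧
        {n : ℕ | ∃ (G H : Type) (_ : Group G) (_ : Group H) (_ : Fintype G) (_ : Fintype H),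
          Fintype.card G = n ∧ Fintype.card H = n ∧
          IsEmpty (G ≃* H) ∧
          GroupWLDimLE K G ∧ GroupWLDimLE K H ∧
          (∃ k : ℕ, c₁ * Real.log n ≤ k ∧ (k : ℝ) ≤ c₂ * Real.log n ∧ EqualProfiles k G H) ∧
          (∀ l : ℕ, 1 ≤ l → (l : ℝ) ≤ c₃ * Real.log n →
            GraphWLEquiv l (commutingGraph G) (commutingGraph H)) ∧
          Monoid.exponent G = p ∧ Monoid.exponent H = p ∧
          HasClassTwo G ∧ HasClassTwo H ∧
          EqualConjClassSizes G H}.Infinite := by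
  refine ⟨6, by norm_num, fun p hp h2 => ?_⟩
  have : Fact p.Prime := ⟨hp⟩
  have hlog : 0 < Real.log p := Real.log_pos (by exact_mod_cast hp.one_lt)
  -- Here log n = (2d + 2) log p and k = (d - 1) / 2, rounded down, is the largest k with 2k < d.
  -- The first two constants turn log n into (d + 1) / 6 and 2d + 2, which enclose k. The third is
  -- arbitrary because the graphs are isomorphic.
  refine ⟨1 / (12 * Real.log p), 1 / Real.log p, 1, by positivity, by positivity, one_pos, ?_⟩
  refine Set.infinite_of_forall_exists_gt fun N => ?_
  obtain ⟨d, hNd, hd⟩ := Nat.exists_infinite_primes (max N 7)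
  have h7 : 7 ≤ d := (le_max_right _ _).trans hNd
  obtain ⟨F, _, _, _, T, T', hcard, hne, hdim, hdim', hprof, ⟨φ⟩⟩ :=
    exists_pencilGroup_pair h2 hd h7
  have hG : ∀ S : F, Fintype.card (PencilGroup p S) = p ^ (2 + 2 * d) := fun S => by
    rw [Fintype.card_eq_nat_card, PencilGroup.natCard, hcard]
    ring
  have hlogn : Real.log ((p ^ (2 + 2 * d) : ℕ) : ℝ) = (2 + 2 * d) * Real.log p := by
    rw [Nat.cast_pow, Real.log_pow]
    push_cast
    rfl
  refine ⟨p ^ (2 + 2 * d), ⟨PencilGroup p T, PencilGroup p T', inferInstance, inferInstance,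
    inferInstance, inferInstance, hG T, hG T', hne, hdim, hdim',
    ⟨(d - 1) / 2, ?_, ?_, hprof _ (by omega)⟩, fun l _ _ => GraphWLEquiv.of_iso φ l,
    PencilGroup.exponent_eq h2, PencilGroup.exponent_eq h2, PencilGroup.hasClassTwo,
    PencilGroup.hasClassTwo, EqualConjClassSizes.of_commutingGraph_iso φ⟩, ?_⟩
  · have hk : d ≤ 2 * ((d - 1) / 2) + 2 := by omega
    have hk' : (d : ℝ) ≤ 2 * (((d - 1) / 2 : ℕ) : ℝ) + 2 := by exact_mod_cast hk
    have h7' : (7 : ℝ) ≤ d := by exact_mod_cast h7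
    have e : 1 / (12 * Real.log p) * ((2 + 2 * (d : ℝ)) * Real.log p) = (1 + d) / 6 := by
      field_simp
      ring
    rw [hlogn, e]
    linarith
  · have hk : (d - 1) / 2 ≤ 2 + 2 * d := by omega
    have e : 1 / Real.log p * ((2 + 2 * (d : ℝ)) * Real.log p) = 2 + 2 * d := by
      field_simp
    rw [hlogn, e]
    exact_mod_cast hk
  · calc N ≤ d := (le_max_left _ _).trans hNd
      _ < 2 + 2 * d := by omega
      _ < p ^ (2 + 2 * d) := Nat.lt_pow_self hp.one_lt
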